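/- **Setting.** Let $d\in\mathbb N$ and let $\mathcal H,\mathcal E,\mathcal E_*$ be complex Hilbert spaces. A *GR-unitary (Givone–Roesser unitary) colligation* is a unitary operator $U=\begin{bmatrix}A&B\\ C&D\end{bmatrix}:\mathcal H\oplus\mathcal E\to\mathcal H\oplus\mathcal E_*$ together with orthogonal projections $P_1,\dots,P_d$ on $\mathcal H$ with pairwise orthogonal ranges and $P_1+\dots+P_d=I$. Put $Z(z)=z_1P_1+\dots+z_dP_d$ and $Z(z)^{-1}=z_1^{-1}P_1+\dots+z_d^{-1}P_d$. The transfer function of $U$ is $S(z)=D+C(I-Z(z)A)^{-1}Z(z)B$, $z\in\mathbb D^d$, and $U$ is then called a realization of $S$. Below, $(I-T)^{-1}=\sum_{N\ge 0}T^N$ in the sense of formal Laurent series in $z=(z_1,\dots,z_d)$. * $U$ is *closely connected* if $\mathcal H$ is the smallest closed subspace of $\mathcal H$ that contains $\operatorname{im}B$ and $\operatorname{im}C^*$ and is invariant under $A$, $A^*$, $P_1,\dots,P_d$. * $U$ is *strictly closely connected* if the map $h\mapsto\begin{bmatrix}C(I-Z(z)A)^{-1}h\\ B^*(I-Z(z)^{-1}A^*)^{-1}Z(z)^{-1}h\end{bmatrix}$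 from $\mathcal H$ to formal Laurent series with coefficients in $\mathcal E_*\oplus\mathcal E$ is injective. * $U$ is *shifted strictly closely connected* if $h\mapsto\begin{bmatrix}C(I-Z(z)A)^{-1}Z(z)h\\ B^*(I-Z(z)^{-1}A^*)^{-1}h\end{bmatrix}$ is injective on $\mathcal H$. * $U$ is *scattering-minimal* if, with $\Xi=\{n\in\mathbb Z^d: n_1+\dots+n_d=0\}$ (the finite boundary of the balanced sublattice $\{n\in\mathbb Z^d:n_1+\dots+n_d\ge 0\}$), the map $$x(z)=\sum_{n\in\Xi}x(n)z^n\ \longmapsto\ \begin{bmatrix}C(I-Z(z)A)^{-1}x(z)\\ B^*Z(z)^{-1}(I-A^*Z(z)^{-1})^{-1}x(z)\end{bmatrix}$$ is injective on the square-summable families $(x(n))_{n\in\Xi}$ in $\mathcal H$. **Statement.** 1. For every GR-unitary colligation $U$: if $U$ is scattering-minimal, then $U$ is strictly closely connected; if $U$ is strictly closely connected, then $U$ is closely connected. 2. For every GR-unitary colligation $U$: if $U$ is scattering-minimal, then $U$ is shifted strictly closely connected; if $U$ is shifted strictly closely connected, then $U$ is closely connected. 3. Let $d=2$, $\mathcal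 H=\mathbb C^4$, $\mathcal E=\mathcal E_*=\mathbb C$, $s=1/\sqrt2$, and $$A=\begin{bmatrix}0&0&-s&0\\0&0&s&0\\-s&s&0&0\\s&s&0&0\end{bmatrix},\quad B=\begin{bmatrix}s\\s\\0\\0\end{bmatrix},\quad C=\begin{bmatrix}0&0&0&1\end{bmatrix},\quad D=0,$$ $$P_1=\begin{bmatrix}1&0&0&0\\0&0&0&0\\0&0&\frac12&\frac12\\0&0&\frac12&\frac12\end{bmatrix},\quad P_2=\begin{bmatrix}0&0&0&0\\0&1&0&0\\0&0&\frac12&-\frac12\\0&0&-\frac12&\frac12\end{bmatrix}.$$ These form a GR-unitary colligation with transfer function $S(z_1,z_2)=z_1z_2$ on $\mathbb D^2$. It is closely connected, but neither strictly closely connected nor shifted strictly closely connected. 4. Let $d=2$, $\mathcal H=\mathbb C^8$, $\mathcal E=\mathcal E_*=\mathbb C^3$, $s=1/\sqrt6$, $t=\sqrt{2/3}$, and $$A=\begin{bmatrix}0&0&0&s&s&0&0&0\\0&0&0&0&t&0&0&0\\0&0&0&t&0&0&0&0\\s&0&t&0&0&0&0&0\\s&t&0&0&0&0&0&0\\0&0&0&s&-s&0&0&0\\0&-s&s&0&0&0&0&0\\-t&s&s&0&0&0&0&0\end{bmatrix},\quad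 B=\begin{bmatrix}0&0&-t\\0&-s&s\\0&s&s\\s&0&0\\-s&0&0\\0&-t&0\\-t&0&0\\0&0&0\end{bmatrix},$$ $$C=\begin{bmatrix}0_{3\times5}&I_3\end{bmatrix},\quad D=0_{3\times 3},\quad P_2=I-P_1,$$ $$P_1=\frac16\begin{bmatrix}5&0&-2&0&0&-1&0&0\\0&0&0&0&0&0&0&0\\-2&0&2&0&0&-2&0&0\\0&0&0&6&0&0&0&0\\0&0&0&0&4&0&-2&2\\-1&0&-2&0&0&5&0&0\\0&0&0&0&-2&0&1&-1\\0&0&0&0&2&0&-1&1\end{bmatrix}.$$ These form a GR-unitary colligation which is both strictly closely connected and shifted strictly closely connected, but not scattering-minimal. -/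

import Mathlib

open scoped BigOperators

noncomputable section

/-- Formal Laurent series `∑ f(n) z^n` (`n ∈ ℤ^d`) in `d` commuting variables with coefficients
in `V`, as families of coefficients: the space `V[[z^{±1}]]`. -/
abbrev FormalLaurent (d : ℕ) (V : Type*) := (Fin d → ℤ) → V

namespace FormalLaurent

/-- The constant series `h · z^0`. -/
def const {d : ℕ} {V : Type*} [Zero V] (h : V) : FormalLaurent d V := Pi.single 0 h

/-- `(I - T)⁻¹ f = ∑_{N ≥ 0} T^N f`, summed coefficient by coefficient.  It is applied below only
to operators `T` raising (or lowering) the total degree by one and to series `f` homogeneous in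
total degree, so that each coefficient is a sum with at most one nonzero term. -/
def resolvent {d : ℕ} {V : Type*} [AddCommMonoid V]
    (T : FormalLaurent d V → FormalLaurent d V) (f : FormalLaurent d V) : FormalLaurent d V :=
  fun n => ∑ᶠ N : ℕ, (T^[N] f) n

end FormalLaurent

/-- A `d`-variable Givone–Roesser unitary colligation in coordinate-free form: a unitary operator
`U : H ⊕ E → H ⊕ E'` (Hilbert space direct sums) together with orthogonal projections
`P 0, …, P (d-1)` on `H` with pairwise orthogonal ranges that together span `H`. -/
structure GRColligation (d : ℕ) (H E E' : Type*)
    [NormedAddCommGroup H] [InnerProductSpace ℂ H] [CompleteSpace H]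
    [NormedAddCommGroup E] [InnerProductSpace ℂ E] [CompleteSpace E]
    [NormedAddCommGroup E'] [InnerProductSpace ℂ E'] [CompleteSpace E'] where
  /-- the unitary colligation operator -/
  U : WithLp 2 (H × E) ≃ₗᵢ[ℂ] WithLp 2 (H × E')
  /-- the orthogonal projections -/
  P : Fin d → H →L[ℂ] H
  isStarProjection_P : ∀ k, IsStarProjection (P k)
  P_mul_P : ∀ j k, j ≠ k → P j * P k = 0
  sum_P : ∑ k, P k = 1

/-- The balanced shift-invariant sublattice `Ω^B = {n ∈ ℤ^d : n₁ + ⋯ + n_d ≥ 0}`. -/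
def balancedLattice (d : ℕ) : Set (Fin d → ℤ) := {n | 0 ≤ ∑ k, n k}

/-- The finite `k`-boundary of `Ω ⊆ ℤ^d`: the points `n` whose `k`-th coordinate is the minimum
of all `m` with `(n₁, …, n_{k-1}, m, n_{k+1}, …, n_d) ∈ Ω`. -/
def finBoundary {d : ℕ} (Ω : Set (Fin d → ℤ)) (k : Fin d) : Set (Fin d → ℤ) :=
  {n | IsLeast {m : ℤ | Function.update n k m ∈ Ω} (n k)}

namespace GRColligation

open ContinuousLinearMap

variable {d : ℕ} {H E E' : Type*}
  [NormedAddCommGroup H] [InnerProductSpace ℂ H] [CompleteSpace H]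
  [NormedAddCommGroup E] [InnerProductSpace ℂ E] [CompleteSpace E]
  [NormedAddCommGroup E'] [InnerProductSpace ℂ E'] [CompleteSpace E']
  (U : GRColligation d H E E')

/-- `U` as a map between the underlying products. -/
def toProd : H × E →L[ℂ] H × E' :=
  (WithLp.prodContinuousLinearEquiv 2 ℂ H E' : WithLp 2 (H × E') →L[ℂ] H × E') ∘L
    (U.U.toContinuousLinearEquiv : WithLp 2 (H × E) →L[ℂ] WithLp 2 (H × E')) ∘L
      ((WithLp.prodContinuousLinearEquiv 2 ℂ H E).symm : H × E →L[ℂ] WithLp 2 (H × E))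

/-- The state block of `U = [A B; C D]`. -/
def A : H →L[ℂ] H := fst ℂ H E' ∘L U.toProd ∘L inl ℂ H E

/-- The input block of `U = [A B; C D]`. -/
def B : E →L[ℂ] H := fst ℂ H E' ∘L U.toProd ∘L inr ℂ H E

/-- The output block of `U = [A B; C D]`. -/
def C : H →L[ℂ] E' := snd ℂ H E' ∘L U.toProd ∘L inl ℂ H E

/-- The feedthrough block of `U = [A B; C D]`. -/
def D : E →L[ℂ] E' := snd ℂ H E' ∘L U.toProd ∘L inr ℂ H E

/-- `Z(z) = z₁ P₁ + ⋯ + z_d P_d` for numbers `z₁, …, z_d`. -/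
def Z (z : Fin d → ℂ) : H →L[ℂ] H := ∑ k, z k • U.P k

/-- The transfer function `S(z) = D + C (I - Z(z) A)⁻¹ Z(z) B`.  For `z` in the open unit polydisk
`‖Z(z) A‖ < 1`, so the inverse there is a genuine one. -/
def transferFunction (z : Fin d → ℂ) : E →L[ℂ] E' :=
  U.D + U.C ∘L Ring.inverse (1 - U.Z z * U.A) ∘L U.Z z ∘L U.B

/-- Multiplication of a formal Laurent series by `Z(z) = ∑ z_k P_k`. -/
def mulZ (f : FormalLaurent d H) : FormalLaurent d H :=
  fun n => ∑ k, U.P k (f (n - Pi.single k 1))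

/-- Multiplication of a formal Laurent series by `Z(z)⁻¹ = ∑ z_k⁻¹ P_k`. -/
def mulZinv (f : FormalLaurent d H) : FormalLaurent d H :=
  fun n => ∑ k, U.P k (f (n + Pi.single k 1))

/-- The smallest closed subspace of `H` that contains `im B` and `im C*` and is invariant under
`A`, `A*` and all `P k`. -/
def closelyConnectedSubspace : Submodule ℂ H :=
  sInf {M : Submodule ℂ H | IsClosed (M : Set H) ∧
    (∀ e, U.B e ∈ M) ∧ (∀ e, adjoint U.C e ∈ M) ∧
    (∀ h ∈ M, U.A h ∈ M) ∧ (∀ h ∈ M, adjoint U.A h ∈ M) ∧ (∀ k, ∀ h ∈ M, U.P k h ∈ M)}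

/-- `U` is closely connected. -/
def IsCloselyConnected : Prop := U.closelyConnectedSubspace = ⊤

/-- The de Branges–Rovnyak identification map
`h ↦ (C (I - Z(z) A)⁻¹ h, B* (I - Z(z)⁻¹ A*)⁻¹ Z(z)⁻¹ h)`. -/
def dBRMap (h : H) : FormalLaurent d E' × FormalLaurent d E :=
  (fun n => U.C (FormalLaurent.resolvent (fun g => U.mulZ fun m => U.A (g m))
      (FormalLaurent.const h) n),
   fun n => adjoint U.B (FormalLaurent.resolvent (fun g => U.mulZinv fun m => adjoint U.A (g m))
      (U.mulZinv (FormalLaurent.const h)) n))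

/-- The shifted de Branges–Rovnyak identification map
`h ↦ (C (I - Z(z) A)⁻¹ Z(z) h, B* (I - Z(z)⁻¹ A*)⁻¹ h)`. -/
def shiftedDBRMap (h : H) : FormalLaurent d E' × FormalLaurent d E :=
  (fun n => U.C (FormalLaurent.resolvent (fun g => U.mulZ fun m => U.A (g m))
      (U.mulZ (FormalLaurent.const h)) n),
   fun n => adjoint U.B (FormalLaurent.resolvent (fun g => U.mulZinv fun m => adjoint U.A (g m))
      (FormalLaurent.const h) n))

/-- `U` is strictly closely connected. -/
def IsStrictlyCloselyConnected : Prop := Function.Injective U.dBRMap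

/-- `U` is shifted strictly closely connected. -/
def IsShiftedStrictlyCloselyConnected : Prop := Function.Injective U.shiftedDBRMap

/-- The space `⨁_k ℓ²(∂_k Ω_fin, im P_k)` of square-summable state data on the finite boundary of
`Ω`, realized as the square-summable families `x : ℤ^d → H` for which `P_k x` is supported on the
finite `k`-boundary of `Ω`. -/
def boundaryData (Ω : Set (Fin d → ℤ)) : Set (FormalLaurent d H) :=
  {x | Memℓp x 2 ∧ ∀ k n, n ∉ finBoundary Ω k → U.P k (x n) = 0}

/-- The map
`x ↦ (C (I - Z(z) A)⁻¹ x(z), B* Z(z)⁻¹ (I - A* Z(z)⁻¹)⁻¹ x(z))`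
which sends state data `x` on the finite boundary to the pair (output, input) of the system
trajectory with these data. -/
def dBRBoundaryMap (x : FormalLaurent d H) : FormalLaurent d E' × FormalLaurent d E :=
  (fun n => U.C (FormalLaurent.resolvent (fun g => U.mulZ fun m => U.A (g m)) x n),
   fun n => adjoint U.B (U.mulZinv
      (FormalLaurent.resolvent (fun g m => adjoint U.A (U.mulZinv g m)) x) n))

/-- `U` is scattering minimal: the map from boundary data to (output, input) is injective on the
data for the balanced sublattice.  (That sublattice has no boundary at infinity, and all of its
finite `k`-boundaries equal `{n : n₁ + ⋯ + n_d = 0}`.) -/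
def IsScatteringMinimal : Prop :=
  Set.InjOn U.dBRBoundaryMap (U.boundaryData (balancedLattice d))

end GRColligation

/-- The operator between Euclidean spaces given by a matrix with real entries. -/
def realMatrixOp {m n : ℕ} (M : Matrix (Fin m) (Fin n) ℝ) :
    EuclideanSpace ℂ (Fin n) →L[ℂ] EuclideanSpace ℂ (Fin m) :=
  (Matrix.toLpLin 2 2 (M.map ((↑) : ℝ → ℂ))).toContinuousLinearMap

namespace FourDimExample

/-- `1/√2` -/
def s : ℝ := 1 / Real.sqrt 2

def A : Matrix (Fin 4) (Fin 4) ℝ :=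
  !![ 0, 0, -s, 0;
      0, 0,  s, 0;
     -s, s,  0, 0;
      s, s,  0, 0]

def B : Matrix (Fin 4) (Fin 1) ℝ := !![s; s; 0; 0]

def C : Matrix (Fin 1) (Fin 4) ℝ := !![0, 0, 0, 1]

def D : Matrix (Fin 1) (Fin 1) ℝ := !![0]

def P₁ : Matrix (Fin 4) (Fin 4) ℝ :=
  !![1, 0, 0, 0;
     0, 0, 0, 0;
     0, 0, 1/2, 1/2;
     0, 0, 1/2, 1/2]

def P₂ : Matrix (Fin 4) (Fin 4) ℝ :=
  !![0, 0, 0, 0;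
     0, 1, 0, 0;
     0, 0,  1/2, -1/2;
     0, 0, -1/2,  1/2]

end FourDimExample

namespace EightDimExample

/-- `1/√6` -/
def s : ℝ := 1 / Real.sqrt 6

/-- `√(2/3)` -/
def t : ℝ := Real.sqrt (2 / 3)

def A : Matrix (Fin 8) (Fin 8) ℝ :=
  !![ 0,  0, 0, s,  s, 0, 0, 0;
      0,  0, 0, 0,  t, 0, 0, 0;
      0,  0, 0, t,  0, 0, 0, 0;
      s,  0, t, 0,  0, 0, 0, 0;
      s,  t, 0, 0,  0, 0, 0, 0;
      0,  0, 0, s, -s, 0, 0, 0;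
      0, -s, s, 0,  0, 0, 0, 0;
     -t,  s, s, 0,  0, 0, 0, 0]

def B : Matrix (Fin 8) (Fin 3) ℝ :=
  !![ 0,  0, -t;
      0, -s,  s;
      0,  s,  s;
      s,  0,  0;
     -s,  0,  0;
      0, -t,  0;
     -t,  0,  0;
      0,  0,  0]

def C : Matrix (Fin 3) (Fin 8) ℝ :=
  !![0, 0, 0, 0, 0, 1, 0, 0;
     0, 0, 0, 0, 0, 0, 1, 0;
     0, 0, 0, 0, 0, 0, 0, 1]

def D : Matrix (Fin 3) (Fin 3) ℝ := 0

def P₁ : Matrix (Fin 8) (Fin 8) ℝ :=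
  !![ 5/6, 0, -1/3, 0,    0, -1/6,    0,    0;
        0, 0,    0, 0,    0,    0,    0,    0;
     -1/3, 0,  1/3, 0,    0, -1/3,    0,    0;
        0, 0,    0, 1,    0,    0,    0,    0;
        0, 0,    0, 0,  2/3,    0, -1/3,  1/3;
     -1/6, 0, -1/3, 0,    0,  5/6,    0,    0;
        0, 0,    0, 0, -1/3,    0,  1/6, -1/6;
        0, 0,    0, 0,  1/3,    0, -1/6,  1/6]

def P₂ : Matrix (Fin 8) (Fin 8) ℝ :=
  !![1/6, 0, 1/3, 0,    0, 1/6,   0,    0;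
       0, 1,   0, 0,    0,   0,   0,    0;
     1/3, 0, 2/3, 0,    0, 1/3,   0,    0;
       0, 0,   0, 0,    0,   0,   0,    0;
       0, 0,   0, 0,  1/3,   0, 1/3, -1/3;
     1/6, 0, 1/3, 0,    0, 1/6,   0,    0;
       0, 0,   0, 0,  1/3,   0, 5/6,  1/6;
       0, 0,   0, 0, -1/3,   0, 1/6,  5/6]

end EightDimExample

end

/-! Multiplication by Z(z) raises total degree by one and multiplication by Z(z)⁻¹ lowers it by one.
On a homogeneous series each coefficient of a resolvent is therefore at most one term of the Neumann
series, and formal identities can be checked term by term (`resolvent_apply`, `mulZinv_resolvent`).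

Implications. Scattering minimality is injectivity on square-summable data of degree zero. The
constant series h is such data, and on it the boundary map is the strict map. The series z_k⁻¹ Z(z)h
is such data too, and on it the boundary map is z_k⁻¹ times the shifted map. Next, the orthogonal
complement of the closely connected subspace reduces A and every P_k and lies in the kernels of C
and B*, so both maps vanish on it. Injectivity of either map makes it zero.

Examples. Coordinates are counted from 0; `Pi.single 0 1` and `Pi.single 1 1` are the exponents of
z₁ and z₂. A map is shown to vanish at a vector by placing the associated series in a set that is
stable under the iterated operator and killed by C or B*. In dimension 4, C(ZA)² = 0 and B*(Z⁻¹A*)²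
= 0, so these sets are cut out by few equations. They contain the series attached to e₂ (strict map)
and to e₀ − e₁ (shifted map). Close connectedness survives because P₁ and P₂ separate e₀ from e₁
inside im B, and A sends these to a basis of the span of e₂, e₃. In dimension 8, the series (z₁g,
z₂g, z₁g, z₁k, z₂k, 0, 0, 0), with g and k scalar series, produce neither output nor input. A
nonzero one is never constant, but two lattice points suffice. Both injectivity claims already
follow from the lowest coefficients. -/

noncomputable section

/-! ### Formal Laurent series, total degree and resolvents -/

namespace FormalLaurent

variable {d : ℕ} {V : Type*}

/-- `f` is homogeneous of total degree `e`. -/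
def IsHomogeneous [Zero V] (f : FormalLaurent d V) (e : ℤ) : Prop :=
  ∀ n, ∑ k, n k ≠ e → f n = 0

/-- `T` shifts the total degree of homogeneous series by `c`. -/
def ShiftsDegree [Zero V] (T : FormalLaurent d V → FormalLaurent d V) (c : ℤ) : Prop :=
  ∀ f e, IsHomogeneous f e → IsHomogeneous (T f) (e + c)

theorem IsHomogeneous.iterate [Zero V] {T : FormalLaurent d V → FormalLaurent d V} {c : ℤ}
    (hT : ShiftsDegree T c) {f : FormalLaurent d V} {e : ℤ} (hf : IsHomogeneous f e) (N : ℕ) :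
    IsHomogeneous (T^[N] f) (e + c * N) := by
  induction N with
  | zero => simpa using hf
  | succ N ih =>
    rw [Function.iterate_succ_apply']
    have := hT _ _ ih
    rwa [show e + c * N + c = e + c * ((N + 1 : ℕ) : ℤ) by push_cast; ring] at this

/-- `T^[N] f` lives in degree `e + c * N`, and these degrees are distinct because `c ≠ 0`. Only one
term of the sum can contribute at `n`. -/
theorem resolvent_apply [AddCommMonoid V] {T : FormalLaurent d V → FormalLaurent d V} {c : ℤ}
    (hc : c ≠ 0) (hT : ShiftsDegree T c) {f : FormalLaurent d V} {e : ℤ} (hf : IsHomogeneous f e)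
    {n : Fin d → ℤ} {N : ℕ} (hn : ∑ k, n k = e + c * N) : resolvent T f n = (T^[N] f) n := by
  refine finsum_eq_single _ N fun M hM => hf.iterate hT M n ?_
  rw [hn]
  intro h
  apply hM
  have : c * (N : ℤ) = c * M := by linarith
  exact_mod_cast (mul_left_cancel₀ hc this).symm

theorem resolvent_apply_of_forall_ne [AddCommMonoid V]
    {T : FormalLaurent d V → FormalLaurent d V} {c : ℤ}
    (hT : ShiftsDegree T c) {f : FormalLaurent d V} {e : ℤ} (hf : IsHomogeneous f e)
    {n : Fin d → ℤ} (hn : ∀ N : ℕ, ∑ k, n k ≠ e + c * N) : resolvent T f n = 0 := by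
  refine (finsum_congr fun M => hf.iterate hT M n (hn M)).trans finsum_zero

theorem isHomogeneous_const [Zero V] (h : V) : IsHomogeneous (const h : FormalLaurent d V) 0 := by
  intro n hn
  rw [const, Pi.single_eq_of_ne]
  rintro rfl
  simp at hn

/-- No homogeneity is needed: if infinitely many terms are nonzero, the finite-support sum takes its
default value 0, which still lies in `M`. -/
theorem resolvent_mem [AddCommMonoid V] {T : FormalLaurent d V → FormalLaurent d V}
    {K : Set (FormalLaurent d V)} (hK : ∀ f ∈ K, T f ∈ K) {M : AddSubmonoid V}
    (hM : ∀ f ∈ K, ∀ n, f n ∈ M) {f : FormalLaurent d V} (hf : f ∈ K) (n : Fin d → ℤ) :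
    resolvent T f n ∈ M := by
  have (N : ℕ) : T^[N] f ∈ K := by
    induction N with
    | zero => exact hf
    | succ N ih => rw [Function.iterate_succ_apply']; exact hK _ ih
  exact finsum_induction (· ∈ M) M.zero_mem (fun _ _ => M.add_mem) fun N => hM _ (this N) n

/-- The series obtained by multiplying with the monomial `z^m`. -/
def mulMonomial (m : Fin d → ℤ) (f : FormalLaurent d V) : FormalLaurent d V := fun n => f (n - m)

theorem resolvent_mulMonomial [AddCommMonoid V] {T : FormalLaurent d V → FormalLaurent d V}
    {m : Fin d → ℤ} (hT : ∀ f, T (mulMonomial m f) = mulMonomial m (T f)) (f : FormalLaurent d V) :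
    resolvent T (mulMonomial m f) = mulMonomial m (resolvent T f) := by
  funext n
  refine finsum_congr fun N => ?_
  have : Function.Semiconj (mulMonomial m) T T := fun g => (hT g).symm
  rw [← (this.iterate_right N).eq f]
  rfl

theorem mulMonomial_inj {m : Fin d → ℤ} {f g : FormalLaurent d V} :
    mulMonomial m f = mulMonomial m g ↔ f = g := by
  refine ⟨fun h => ?_, fun h => h ▸ rfl⟩
  funext n
  simpa [mulMonomial] using congrFun h (n + m)

theorem const_injective [Zero V] : Function.Injective (const : V → FormalLaurent d V) :=
  fun _ _ h => by simpa [const] using congrFun h 0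

theorem sum_add_single (n : Fin d → ℤ) (k : Fin d) :
    ∑ j, (n + Pi.single k 1 : Fin d → ℤ) j = ∑ j, n j + 1 := by
  simp [Finset.sum_add_distrib]

theorem sum_sub_single (n : Fin d → ℤ) (k : Fin d) :
    ∑ j, (n - Pi.single k 1 : Fin d → ℤ) j = ∑ j, n j - 1 := by
  simp [Finset.sum_sub_distrib]

theorem memlp_two_of_finite_support [NormedAddCommGroup V] {f : FormalLaurent d V}
    (hf : (Function.support f).Finite) :
    Memℓp f 2 :=
  (memℓp_zero hf).of_exponent_ge (by simp)

/-- With the delta function as a scalar factor, every coordinate of a constant series becomes a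
multiple of that one scalar. -/
theorem const_eq_smul [AddCommGroup V] [Module ℂ V] (h : V) (n : Fin d → ℤ) :
    const h n = (Pi.single 0 1 : (Fin d → ℤ) → ℂ) n • h := by
  rw [const, Pi.single_apply, Pi.single_apply]
  split_ifs <;> simp

theorem IsHomogeneous.add [AddMonoid V] {f g : FormalLaurent d V} {e : ℤ}
    (hf : IsHomogeneous f e) (hg : IsHomogeneous g e) : IsHomogeneous (f + g) e := by
  intro n hn
  rw [Pi.add_apply, hf n hn, hg n hn, add_zero]

theorem finite_support_const [Zero V] (h : V) :
    (Function.support (const h : FormalLaurent d V)).Finite :=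
  (Set.finite_singleton 0).subset Pi.support_single_subset

theorem finite_support_mulMonomial [Zero V] {m : Fin d → ℤ} {f : FormalLaurent d V}
    (hf : (Function.support f).Finite) : (Function.support (mulMonomial m f)).Finite :=
  hf.preimage (sub_left_injective (b := m)).injOn

theorem isHomogeneous_mulMonomial [Zero V] {m : Fin d → ℤ} {f : FormalLaurent d V} {e : ℤ}
    (hf : IsHomogeneous f e) : IsHomogeneous (mulMonomial m f) (e + ∑ k, m k) := by
  intro n hn
  refine hf _ fun h => hn ?_
  rw [← h]
  simp [Finset.sum_sub_distrib]

theorem mem_finBoundary_balancedLattice {n : Fin d → ℤ} (hn : ∑ k, n k = 0) (k : Fin d) :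
    n ∈ finBoundary (balancedLattice d) k := by
  have h (m : ℤ) : ∑ j, Function.update n k m j = m - n k := by
    rw [Finset.sum_update_of_mem (Finset.mem_univ k)]
    have := Finset.add_sum_erase Finset.univ n (Finset.mem_univ k)
    rw [Finset.sdiff_singleton_eq_erase]
    omega
  constructor
  · simp only [balancedLattice, Set.mem_ofPred_eq, h]
    omega
  · intro m hm
    simp only [balancedLattice, Set.mem_ofPred_eq, h] at hm
    omega

/-- The series with coefficients in a subspace `M`. -/
def seriesIn (d : ℕ) [AddCommGroup V] [Module ℂ V] (M : Submodule ℂ V) :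
    Set (FormalLaurent d V) := {f | ∀ n, f n ∈ M}

theorem const_mem_seriesIn [AddCommGroup V] [Module ℂ V] {M : Submodule ℂ V} {h : V} (hh : h ∈ M) :
    const h ∈ seriesIn d M := by
  intro n
  rw [const, Pi.single_apply]
  split_ifs
  exacts [hh, M.zero_mem]

end FormalLaurent

/-! ### Scattering minimality implies both strict notions -/

namespace GRColligation

open ContinuousLinearMap (adjoint adjoint_inner_left adjoint_inner_right)
open FormalLaurent

variable {d : ℕ} {H E E' : Type*}
  [NormedAddCommGroup H] [InnerProductSpace ℂ H] [CompleteSpace H]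
  [NormedAddCommGroup E] [InnerProductSpace ℂ E] [CompleteSpace E]
  [NormedAddCommGroup E'] [InnerProductSpace ℂ E'] [CompleteSpace E']
  (U : GRColligation d H E E')

theorem shiftsDegree_mulZ (L : H →L[ℂ] H) : ShiftsDegree (fun g => U.mulZ fun m => L (g m)) 1 := by
  intro f e hf n hn
  refine Finset.sum_eq_zero fun k _ => ?_
  beta_reduce
  rw [hf, map_zero, map_zero]
  rw [sum_sub_single]
  omega

theorem shiftsDegree_mulZinv (L : H →L[ℂ] H) :
    ShiftsDegree (fun g => U.mulZinv fun m => L (g m)) (-1) := by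
  intro f e hf n hn
  refine Finset.sum_eq_zero fun k _ => ?_
  beta_reduce
  rw [hf, map_zero, map_zero]
  rw [sum_add_single]
  omega

theorem shiftsDegree_comp_mulZinv (L : H →L[ℂ] H) :
    ShiftsDegree (fun g m => L (U.mulZinv g m)) (-1) := by
  intro f e hf n hn
  simp only
  rw [show U.mulZinv f n = 0 from U.shiftsDegree_mulZinv (ContinuousLinearMap.id ℂ H) f e hf n hn,
    map_zero]

theorem isHomogeneous_mulZ {f : FormalLaurent d H} {e : ℤ} (hf : IsHomogeneous f e) :
    IsHomogeneous (U.mulZ f) (e + 1) :=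
  U.shiftsDegree_mulZ (ContinuousLinearMap.id ℂ H) f e hf

theorem isHomogeneous_mulZinv {f : FormalLaurent d H} {e : ℤ} (hf : IsHomogeneous f e) :
    IsHomogeneous (U.mulZinv f) (e - 1) :=
  U.shiftsDegree_mulZinv (ContinuousLinearMap.id ℂ H) f e hf

theorem mulZ_mulMonomial (m : Fin d → ℤ) (f : FormalLaurent d H) :
    U.mulZ (mulMonomial m f) = mulMonomial m (U.mulZ f) := by
  funext n
  simp only [mulZ, mulMonomial]
  exact Finset.sum_congr rfl fun k _ => by rw [sub_right_comm]

theorem mulZinv_mulMonomial (m : Fin d → ℤ) (f : FormalLaurent d H) :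
    U.mulZinv (mulMonomial m f) = mulMonomial m (U.mulZinv f) := by
  funext n
  simp only [mulZinv, mulMonomial]
  exact Finset.sum_congr rfl fun k _ => by rw [sub_add_eq_add_sub]

theorem P_P_apply (j k : Fin d) (h : H) : U.P j (U.P k h) = if j = k then U.P k h else 0 := by
  split_ifs with hjk
  · subst hjk
    exact congrArg (· h) (U.isStarProjection_P j).isIdempotentElem.eq
  · exact congrArg (· h) (U.P_mul_P j k hjk)

theorem sum_P_apply (h : H) : ∑ k, U.P k h = h := by
  have := congrArg (· h) U.sum_P
  simpa using this

theorem mulZinv_mulZ (f : FormalLaurent d H) : U.mulZinv (U.mulZ f) = f := by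
  funext n
  simp [mulZinv, mulZ, map_sum, P_P_apply, sum_P_apply]

/-- On homogeneous series, `Z⁻¹ (I - A* Z⁻¹)⁻¹ = (I - Z⁻¹ A*)⁻¹ Z⁻¹`. -/
theorem mulZinv_resolvent (L : H →L[ℂ] H) {f : FormalLaurent d H} {e : ℤ}
    (hf : IsHomogeneous f e) :
    U.mulZinv (resolvent (fun g m => L (U.mulZinv g m)) f) =
      resolvent (fun g => U.mulZinv fun m => L (g m)) (U.mulZinv f) := by
  funext n
  have hs : Function.Semiconj U.mulZinv (fun g m => L (U.mulZinv g m))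
      (fun g => U.mulZinv fun m => L (g m)) := fun g => rfl
  -- The degree of `n` selects at most one iterate, so Z⁻¹ only has to pass through that term.
  -- Without homogeneity the sums could have infinite support, and Z⁻¹ need not commute with their
  -- default value.
  by_cases h : ∃ N : ℕ, ∑ k, n k = (e - 1) + -1 * N
  · obtain ⟨N, hN⟩ := h
    rw [resolvent_apply (by norm_num) (U.shiftsDegree_mulZinv L) (U.isHomogeneous_mulZinv hf) hN,
      ← (hs.iterate_right N).eq f]
    refine Finset.sum_congr rfl fun k _ => ?_
    rw [resolvent_apply (by norm_num) (U.shiftsDegree_comp_mulZinv L) hf (N := N)]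
    rw [sum_add_single, hN]
    ring
  · push Not at h
    rw [resolvent_apply_of_forall_ne (U.shiftsDegree_mulZinv L) (U.isHomogeneous_mulZinv hf) h]
    refine Finset.sum_eq_zero fun k _ => ?_
    rw [resolvent_apply_of_forall_ne (U.shiftsDegree_comp_mulZinv L) hf, map_zero]
    intro N
    have := h N
    rw [sum_add_single]
    omega

theorem mem_boundaryData_of_isHomogeneous {f : FormalLaurent d H} (hf : IsHomogeneous f 0)
    (hfin : (Function.support f).Finite) : f ∈ U.boundaryData (balancedLattice d) := by
  refine ⟨memlp_two_of_finite_support hfin, fun k n hn => ?_⟩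
  rw [hf, map_zero]
  exact fun h => hn (mem_finBoundary_balancedLattice h k)

theorem const_mem_boundaryData (h : H) : const h ∈ U.boundaryData (balancedLattice d) :=
  U.mem_boundaryData_of_isHomogeneous (isHomogeneous_const h) (finite_support_const h)

theorem dBRBoundaryMap_const (h : H) : U.dBRBoundaryMap (const h) = U.dBRMap h := by
  rw [dBRBoundaryMap, dBRMap, U.mulZinv_resolvent _ (isHomogeneous_const h)]

theorem IsScatteringMinimal.isStrictlyCloselyConnected {U : GRColligation d H E E'}
    (hU : U.IsScatteringMinimal) : U.IsStrictlyCloselyConnected := by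
  intro h₁ h₂ h
  rw [← dBRBoundaryMap_const, ← dBRBoundaryMap_const] at h
  exact const_injective (hU (U.const_mem_boundaryData h₁) (U.const_mem_boundaryData h₂) h)

theorem finite_support_mulZ {f : FormalLaurent d H} (hf : (Function.support f).Finite) :
    (Function.support (U.mulZ f)).Finite := by
  refine (Set.finite_iUnion fun k : Fin d =>
    hf.preimage (sub_left_injective (b := (Pi.single k 1 : Fin d → ℤ))).injOn).subset ?_
  intro n hn
  obtain ⟨k, -, hk⟩ := Finset.exists_ne_zero_of_sum_ne_zero hn
  refine Set.mem_iUnion.2 ⟨k, fun h0 => hk ?_⟩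
  simp only at h0
  rw [h0, map_zero]

/-- The shifted map is the boundary map on the data `z_k⁻¹ Z(z) h`, up to the factor `z_k⁻¹`. -/
theorem dBRBoundaryMap_mulMonomial_mulZ_const (k : Fin d) (h : H) :
    U.dBRBoundaryMap (mulMonomial (-Pi.single k 1) (U.mulZ (const h))) =
      (mulMonomial (-Pi.single k 1) (U.shiftedDBRMap h).1,
        mulMonomial (-Pi.single k 1) (U.shiftedDBRMap h).2) := by
  have hh := isHomogeneous_mulMonomial (m := -Pi.single k 1)
    (U.isHomogeneous_mulZ (isHomogeneous_const h))
  rw [dBRBoundaryMap, U.mulZinv_resolvent _ hh, mulZinv_mulMonomial, mulZinv_mulZ,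
    resolvent_mulMonomial (T := fun g => U.mulZinv fun m => adjoint U.A (g m))
      (fun f => U.mulZinv_mulMonomial _ fun m => adjoint U.A (f m)),
    resolvent_mulMonomial (T := fun g => U.mulZ fun m => U.A (g m))
      (fun f => U.mulZ_mulMonomial _ fun m => U.A (f m))]
  rfl

theorem IsScatteringMinimal.isShiftedStrictlyCloselyConnected {U : GRColligation d H E E'}
    (hU : U.IsScatteringMinimal) : U.IsShiftedStrictlyCloselyConnected := by
  intro h₁ h₂ h
  -- For d = 0 there is no variable to divide by, but then the identity of H is an empty sum and H
  -- is trivial.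
  rcases isEmpty_or_nonempty (Fin d) with hd | ⟨⟨k⟩⟩
  · rw [← U.sum_P_apply h₁, ← U.sum_P_apply h₂]
    simp
  -- Z(z)h has degree one; the factor z_k⁻¹ brings it back to degree zero, where the boundary data
  -- live.
  have mem (h : H) : mulMonomial (-Pi.single k 1) (U.mulZ (const h)) ∈
      U.boundaryData (balancedLattice d) := by
    refine U.mem_boundaryData_of_isHomogeneous ?_
      (finite_support_mulMonomial (U.finite_support_mulZ (finite_support_const h)))
    convert isHomogeneous_mulMonomial (m := -Pi.single k 1)
      (U.isHomogeneous_mulZ (isHomogeneous_const h)) using 1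
    simp
  have := hU (mem h₁) (mem h₂)
    (by rw [dBRBoundaryMap_mulMonomial_mulZ_const, dBRBoundaryMap_mulMonomial_mulZ_const, h])
  have := congrArg U.mulZinv (mulMonomial_inj.1 this)
  rw [mulZinv_mulZ, mulZinv_mulZ] at this
  exact const_injective this

/-! ### Invariant sets of series and close connectedness -/

theorem mulZ_mem_seriesIn {M : Submodule ℂ H} (hM : ∀ k, ∀ h ∈ M, U.P k h ∈ M)
    {f : FormalLaurent d H} (hf : f ∈ seriesIn d M) : U.mulZ f ∈ seriesIn d M :=
  fun _ => M.sum_mem fun k _ => hM k _ (hf _)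

theorem mulZinv_mem_seriesIn {M : Submodule ℂ H} (hM : ∀ k, ∀ h ∈ M, U.P k h ∈ M)
    {f : FormalLaurent d H} (hf : f ∈ seriesIn d M) : U.mulZinv f ∈ seriesIn d M :=
  fun _ => M.sum_mem fun k _ => hM k _ (hf _)

theorem C_resolvent_eq_zero {K : Set (FormalLaurent d H)}
    (hK : ∀ f ∈ K, (U.mulZ fun m => U.A (f m)) ∈ K) (hC : ∀ f ∈ K, ∀ n, U.C (f n) = 0)
    {f : FormalLaurent d H} (hf : f ∈ K) (n : Fin d → ℤ) :
    U.C (resolvent (fun g => U.mulZ fun m => U.A (g m)) f n) = 0 :=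
  resolvent_mem (M := (LinearMap.ker (U.C : H →ₗ[ℂ] E')).toAddSubmonoid) hK hC hf n

theorem adjoint_B_resolvent_eq_zero {K : Set (FormalLaurent d H)}
    (hK : ∀ f ∈ K, (U.mulZinv fun m => adjoint U.A (f m)) ∈ K)
    (hB : ∀ f ∈ K, ∀ n, adjoint U.B (f n) = 0)
    {f : FormalLaurent d H} (hf : f ∈ K) (n : Fin d → ℤ) :
    adjoint U.B (resolvent (fun g => U.mulZinv fun m => adjoint U.A (g m)) f n) = 0 :=
  resolvent_mem (M := (LinearMap.ker (adjoint U.B : H →ₗ[ℂ] E)).toAddSubmonoid) hK hB hf n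

/-- The output and input components iterate different operators from different starting series, so
each gets its own invariant set. -/
theorem dBRMap_eq_zero {K K' : Set (FormalLaurent d H)}
    (hK : ∀ f ∈ K, (U.mulZ fun m => U.A (f m)) ∈ K) (hC : ∀ f ∈ K, ∀ n, U.C (f n) = 0)
    (hK' : ∀ f ∈ K', (U.mulZinv fun m => adjoint U.A (f m)) ∈ K')
    (hB : ∀ f ∈ K', ∀ n, adjoint U.B (f n) = 0)
    {h : H} (hh : const h ∈ K) (hh' : U.mulZinv (const h) ∈ K') : U.dBRMap h = 0 :=
  Prod.ext (funext fun n => U.C_resolvent_eq_zero hK hC hh n)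
    (funext fun n => U.adjoint_B_resolvent_eq_zero hK' hB hh' n)

theorem shiftedDBRMap_eq_zero {K K' : Set (FormalLaurent d H)}
    (hK : ∀ f ∈ K, (U.mulZ fun m => U.A (f m)) ∈ K) (hC : ∀ f ∈ K, ∀ n, U.C (f n) = 0)
    (hK' : ∀ f ∈ K', (U.mulZinv fun m => adjoint U.A (f m)) ∈ K')
    (hB : ∀ f ∈ K', ∀ n, adjoint U.B (f n) = 0)
    {h : H} (hh : U.mulZ (const h) ∈ K) (hh' : const h ∈ K') : U.shiftedDBRMap h = 0 :=
  Prod.ext (funext fun n => U.C_resolvent_eq_zero hK hC hh n)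
    (funext fun n => U.adjoint_B_resolvent_eq_zero hK' hB hh' n)

/-- The orthogonal complement of the closely connected subspace, which reduces the colligation. -/
def unconnectedSubspace : Submodule ℂ H := U.closelyConnectedSubspaceᗮ

theorem B_mem_closelyConnectedSubspace (e : E) : U.B e ∈ U.closelyConnectedSubspace :=
  Submodule.mem_sInf.2 fun _ hM => hM.2.1 e

theorem adjoint_C_mem_closelyConnectedSubspace (e : E') :
    adjoint U.C e ∈ U.closelyConnectedSubspace :=
  Submodule.mem_sInf.2 fun _ hM => hM.2.2.1 e

theorem A_mem_closelyConnectedSubspace {h : H} (hh : h ∈ U.closelyConnectedSubspace) :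
    U.A h ∈ U.closelyConnectedSubspace :=
  Submodule.mem_sInf.2 fun M hM => hM.2.2.2.1 h (Submodule.mem_sInf.1 hh M hM)

theorem adjoint_A_mem_closelyConnectedSubspace {h : H} (hh : h ∈ U.closelyConnectedSubspace) :
    adjoint U.A h ∈ U.closelyConnectedSubspace :=
  Submodule.mem_sInf.2 fun M hM => hM.2.2.2.2.1 h (Submodule.mem_sInf.1 hh M hM)

theorem P_mem_closelyConnectedSubspace (k : Fin d) {h : H} (hh : h ∈ U.closelyConnectedSubspace) :
    U.P k h ∈ U.closelyConnectedSubspace :=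
  Submodule.mem_sInf.2 fun M hM => hM.2.2.2.2.2 k h (Submodule.mem_sInf.1 hh M hM)

theorem isClosed_closelyConnectedSubspace : IsClosed (U.closelyConnectedSubspace : Set H) := by
  rw [closelyConnectedSubspace, Submodule.coe_sInf]
  exact isClosed_biInter fun M hM => hM.1

/-- Invariance of a subspace under an operator passes to invariance of its orthogonal complement
under the adjoint. -/
theorem A_mem_unconnectedSubspace {h : H} (hh : h ∈ U.unconnectedSubspace) :
    U.A h ∈ U.unconnectedSubspace := fun u hu => by
  rw [← adjoint_inner_left]
  exact hh _ (U.adjoint_A_mem_closelyConnectedSubspace hu)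

theorem adjoint_A_mem_unconnectedSubspace {h : H} (hh : h ∈ U.unconnectedSubspace) :
    adjoint U.A h ∈ U.unconnectedSubspace := fun u hu => by
  rw [adjoint_inner_right]
  exact hh _ (U.A_mem_closelyConnectedSubspace hu)

theorem P_mem_unconnectedSubspace (k : Fin d) {h : H} (hh : h ∈ U.unconnectedSubspace) :
    U.P k h ∈ U.unconnectedSubspace := fun u hu => by
  have hP : adjoint (U.P k) = U.P k := (U.isStarProjection_P k).isSelfAdjoint.star_eq
  rw [← hP, adjoint_inner_right]
  exact hh _ (U.P_mem_closelyConnectedSubspace k hu)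

theorem C_eq_zero_of_mem_unconnectedSubspace {h : H} (hh : h ∈ U.unconnectedSubspace) :
    U.C h = 0 := by
  refine ext_inner_left ℂ fun v => ?_
  rw [inner_zero_right, ← adjoint_inner_left]
  exact hh _ (U.adjoint_C_mem_closelyConnectedSubspace v)

theorem adjoint_B_eq_zero_of_mem_unconnectedSubspace {h : H} (hh : h ∈ U.unconnectedSubspace) :
    adjoint U.B h = 0 := by
  refine ext_inner_left ℂ fun v => ?_
  rw [inner_zero_right, adjoint_inner_right]
  exact hh _ (U.B_mem_closelyConnectedSubspace v)

theorem isCloselyConnected_of_unconnectedSubspace_eq_bot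
    (h : ∀ x ∈ U.unconnectedSubspace, x = 0) : U.IsCloselyConnected := by
  -- A zero orthogonal complement forces the whole space only for a closed, hence complete,
  -- subspace.
  have := U.isClosed_closelyConnectedSubspace.completeSpace_coe
  exact Submodule.orthogonal_eq_bot_iff.1 ((Submodule.eq_bot_iff _).2 h)

theorem dBRMap_eq_zero_of_mem_unconnectedSubspace {h : H} (hh : h ∈ U.unconnectedSubspace) :
    U.dBRMap h = 0 :=
  U.dBRMap_eq_zero (K := seriesIn d U.unconnectedSubspace) (K' := seriesIn d U.unconnectedSubspace)
    (fun _ hf => U.mulZ_mem_seriesIn (fun k _ => U.P_mem_unconnectedSubspace k)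
      fun n => U.A_mem_unconnectedSubspace (hf n))
    (fun _ hf n => U.C_eq_zero_of_mem_unconnectedSubspace (hf n))
    (fun _ hf => U.mulZinv_mem_seriesIn (fun k _ => U.P_mem_unconnectedSubspace k)
      fun n => U.adjoint_A_mem_unconnectedSubspace (hf n))
    (fun _ hf n => U.adjoint_B_eq_zero_of_mem_unconnectedSubspace (hf n))
    (const_mem_seriesIn hh)
    (U.mulZinv_mem_seriesIn (fun k _ => U.P_mem_unconnectedSubspace k) (const_mem_seriesIn hh))

theorem shiftedDBRMap_eq_zero_of_mem_unconnectedSubspace {h : H}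
    (hh : h ∈ U.unconnectedSubspace) : U.shiftedDBRMap h = 0 :=
  U.shiftedDBRMap_eq_zero (K := seriesIn d U.unconnectedSubspace)
    (K' := seriesIn d U.unconnectedSubspace)
    (fun _ hf => U.mulZ_mem_seriesIn (fun k _ => U.P_mem_unconnectedSubspace k)
      fun n => U.A_mem_unconnectedSubspace (hf n))
    (fun _ hf n => U.C_eq_zero_of_mem_unconnectedSubspace (hf n))
    (fun _ hf => U.mulZinv_mem_seriesIn (fun k _ => U.P_mem_unconnectedSubspace k)
      fun n => U.adjoint_A_mem_unconnectedSubspace (hf n))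
    (fun _ hf n => U.adjoint_B_eq_zero_of_mem_unconnectedSubspace (hf n))
    (U.mulZ_mem_seriesIn (fun k _ => U.P_mem_unconnectedSubspace k) (const_mem_seriesIn hh))
    (const_mem_seriesIn hh)

theorem IsStrictlyCloselyConnected.isCloselyConnected {U : GRColligation d H E E'}
    (hU : U.IsStrictlyCloselyConnected) : U.IsCloselyConnected :=
  U.isCloselyConnected_of_unconnectedSubspace_eq_bot fun x hx => hU <| by
    rw [U.dBRMap_eq_zero_of_mem_unconnectedSubspace hx,
      U.dBRMap_eq_zero_of_mem_unconnectedSubspace U.unconnectedSubspace.zero_mem]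

theorem IsShiftedStrictlyCloselyConnected.isCloselyConnected {U : GRColligation d H E E'}
    (hU : U.IsShiftedStrictlyCloselyConnected) : U.IsCloselyConnected :=
  U.isCloselyConnected_of_unconnectedSubspace_eq_bot fun x hx => hU <| by
    rw [U.shiftedDBRMap_eq_zero_of_mem_unconnectedSubspace hx,
      U.shiftedDBRMap_eq_zero_of_mem_unconnectedSubspace U.unconnectedSubspace.zero_mem]

theorem not_isStrictlyCloselyConnected_of_dBRMap_eq_zero {h : H} (h0 : h ≠ 0)
    (hh : U.dBRMap h = 0) : ¬ U.IsStrictlyCloselyConnected := fun hU => h0 <| hU <| by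
  rw [hh, U.dBRMap_eq_zero_of_mem_unconnectedSubspace U.unconnectedSubspace.zero_mem]

theorem not_isShiftedStrictlyCloselyConnected_of_shiftedDBRMap_eq_zero {h : H} (h0 : h ≠ 0)
    (hh : U.shiftedDBRMap h = 0) : ¬ U.IsShiftedStrictlyCloselyConnected := fun hU => h0 <| hU <| by
  rw [hh, U.shiftedDBRMap_eq_zero_of_mem_unconnectedSubspace U.unconnectedSubspace.zero_mem]

/-! ### Lowest coefficients, and vanishing of the boundary map -/

theorem dBRMap_fst_zero (h : H) : (U.dBRMap h).1 0 = U.C h := by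
  simp only [dBRMap]
  rw [resolvent_apply one_ne_zero (U.shiftsDegree_mulZ U.A) (isHomogeneous_const h) (N := 0)
    (by simp)]
  simp [const]

theorem dBRMap_snd_neg_single (h : H) (k : Fin d) :
    (U.dBRMap h).2 (-Pi.single k 1) = adjoint U.B (U.P k h) := by
  simp only [dBRMap]
  rw [resolvent_apply (by norm_num) (U.shiftsDegree_mulZinv (adjoint U.A))
    (U.isHomogeneous_mulZinv (isHomogeneous_const h)) (N := 0) (by simp)]
  simp only [Function.iterate_zero, id, mulZinv]
  rw [Finset.sum_eq_single k]
  · simp [const]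
  · intro j _ hj
    rw [const, Pi.single_eq_of_ne, map_zero]
    intro h0
    have := congrFun h0 j
    simp [hj] at this
  · simp

theorem shiftedDBRMap_fst_single (h : H) (k : Fin d) :
    (U.shiftedDBRMap h).1 (Pi.single k 1) = U.C (U.P k h) := by
  simp only [shiftedDBRMap]
  rw [resolvent_apply one_ne_zero (U.shiftsDegree_mulZ U.A)
    (U.isHomogeneous_mulZ (isHomogeneous_const h)) (N := 0) (by simp)]
  simp only [Function.iterate_zero, id, mulZ]
  rw [Finset.sum_eq_single k]
  · simp [const]
  · intro j _ hj
    rw [const, Pi.single_eq_of_ne, map_zero]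
    intro h0
    have := congrFun h0 j
    simp [hj] at this
  · simp

theorem shiftedDBRMap_snd_zero (h : H) : (U.shiftedDBRMap h).2 0 = adjoint U.B h := by
  simp only [shiftedDBRMap]
  rw [resolvent_apply (by norm_num) (U.shiftsDegree_mulZinv (adjoint U.A))
    (isHomogeneous_const h) (N := 0) (by simp)]
  simp [const]

/-- Only the N = 0 terms are used: C h in degree 0 and B* P_k h at z_k⁻¹. -/
theorem isStrictlyCloselyConnected_of_forall
    (hU : ∀ h, U.C h = 0 → (∀ k, adjoint U.B (U.P k h) = 0) → h = 0) :
    U.IsStrictlyCloselyConnected := by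
  intro h₁ h₂ h
  refine sub_eq_zero.1 (hU _ ?_ fun k => ?_)
  · rw [map_sub, ← dBRMap_fst_zero, ← dBRMap_fst_zero, h, sub_self]
  · rw [map_sub, map_sub, ← dBRMap_snd_neg_single, ← dBRMap_snd_neg_single, h, sub_self]

theorem isShiftedStrictlyCloselyConnected_of_forall
    (hU : ∀ h, (∀ k, U.C (U.P k h) = 0) → adjoint U.B h = 0 → h = 0) :
    U.IsShiftedStrictlyCloselyConnected := by
  intro h₁ h₂ h
  refine sub_eq_zero.1 (hU _ (fun k => ?_) ?_)
  · rw [map_sub, map_sub, ← shiftedDBRMap_fst_single, ← shiftedDBRMap_fst_single, h, sub_self]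
  · rw [map_sub, ← shiftedDBRMap_snd_zero, ← shiftedDBRMap_snd_zero, h, sub_self]

/-- Homogeneity allows Z⁻¹ to be moved inside the resolvent. Invariance of `K` under A*Z⁻¹ then
becomes invariance of Z⁻¹K under Z⁻¹A*, so one set serves both components. -/
theorem dBRBoundaryMap_eq_zero {K : Set (FormalLaurent d H)}
    (hK : ∀ f ∈ K, (U.mulZ fun m => U.A (f m)) ∈ K) (hC : ∀ f ∈ K, ∀ n, U.C (f n) = 0)
    (hK' : ∀ f ∈ K, (fun m => adjoint U.A (U.mulZinv f m)) ∈ K)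
    (hB : ∀ f ∈ K, ∀ n, adjoint U.B (U.mulZinv f n) = 0)
    {x : FormalLaurent d H} (hx : x ∈ K) {e : ℤ} (he : IsHomogeneous x e) :
    U.dBRBoundaryMap x = 0 := by
  rw [dBRBoundaryMap, U.mulZinv_resolvent _ he]
  refine Prod.ext (funext fun n => U.C_resolvent_eq_zero hK hC hx n)
    (funext fun n => U.adjoint_B_resolvent_eq_zero (K := U.mulZinv '' K) ?_ ?_ ⟨x, hx, rfl⟩ n)
  · rintro _ ⟨f, hf, rfl⟩
    exact ⟨_, hK' f hf, rfl⟩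
  · rintro _ ⟨f, hf, rfl⟩ n
    exact hB f hf n

theorem dBRBoundaryMap_zero : U.dBRBoundaryMap 0 = 0 := by
  have h0 : (const 0 : FormalLaurent d H) = 0 := by simp [const]
  rw [← h0, dBRBoundaryMap_const,
    U.dBRMap_eq_zero_of_mem_unconnectedSubspace U.unconnectedSubspace.zero_mem]

end GRColligation

/-! ### Colligations from finite-dimensional blocks -/

namespace GRColligation

open ContinuousLinearMap (adjoint adjoint_inner_left adjoint_inner_right)
open Module (finrank)

section OfBlocks

variable {d : ℕ} {H E E' : Type*}
  [NormedAddCommGroup H] [InnerProductSpace ℂ H] [CompleteSpace H] [FiniteDimensional ℂ H]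
  [NormedAddCommGroup E] [InnerProductSpace ℂ E] [CompleteSpace E] [FiniteDimensional ℂ E]
  [NormedAddCommGroup E'] [InnerProductSpace ℂ E'] [CompleteSpace E'] [FiniteDimensional ℂ E']

/-- The linear isometry between Hilbert space direct sums with an isometric block matrix. -/
def isometryOfBlocks (A : H →L[ℂ] H) (B : E →L[ℂ] H) (C : H →L[ℂ] E') (D : E →L[ℂ] E')
    (h₁ : adjoint A ∘L A + adjoint C ∘L C = 1) (h₂ : adjoint A ∘L B + adjoint C ∘L D = 0)
    (h₃ : adjoint B ∘L B + adjoint D ∘L D = 1) :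
    WithLp 2 (H × E) →ₗᵢ[ℂ] WithLp 2 (H × E') :=
  LinearMap.isometryOfInner
    ((WithLp.linearEquiv 2 ℂ (H × E')).symm.toLinearMap ∘ₗ
      ((A.coprod B).prod (C.coprod D)).toLinearMap ∘ₗ (WithLp.linearEquiv 2 ℂ (H × E)).toLinearMap)
    (by
      intro x y
      -- These four identities are the entries of U*U = I; the lower left one is the conjugate of
      -- the upper right one.
      have e₁ (h h' : H) : inner ℂ (A h) (A h') + inner ℂ (C h) (C h') = inner ℂ h h' := by
        rw [← adjoint_inner_right, ← adjoint_inner_right, ← inner_add_right]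
        exact congrArg (fun L : H →L[ℂ] H => inner ℂ h (L h')) h₁
      have e₂ (h : H) (e : E) : inner ℂ (A h) (B e) + inner ℂ (C h) (D e) = 0 := by
        rw [← adjoint_inner_right, ← adjoint_inner_right, ← inner_add_right]
        exact (congrArg (fun L : E →L[ℂ] H => inner ℂ h (L e)) h₂).trans (inner_zero_right _)
      have e₂' (h : H) (e : E) : inner ℂ (B e) (A h) + inner ℂ (D e) (C h) = 0 := by
        rw [← inner_conj_symm, ← inner_conj_symm (D e), ← map_add, e₂, map_zero]
      have e₃ (e e' : E) : inner ℂ (B e) (B e') + inner ℂ (D e) (D e') = inner ℂ e e' := by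
        rw [← adjoint_inner_right, ← adjoint_inner_right, ← inner_add_right]
        exact congrArg (fun L : E →L[ℂ] E => inner ℂ e (L e')) h₃
      rw [WithLp.prod_inner_apply, WithLp.prod_inner_apply]
      change inner ℂ (A x.fst + B x.snd) (A y.fst + B y.snd) +
        inner ℂ (C x.fst + D x.snd) (C y.fst + D y.snd) =
          inner ℂ x.fst y.fst + inner ℂ x.snd y.snd
      simp only [inner_add_left, inner_add_right]
      linear_combination e₁ x.fst y.fst + e₂ x.fst y.snd + e₂' y.fst x.snd + e₃ x.snd y.snd)

/-- The Givone–Roesser unitary colligation with given blocks on finite-dimensional spaces. -/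
def ofBlocks (A : H →L[ℂ] H) (B : E →L[ℂ] H) (C : H →L[ℂ] E') (D : E →L[ℂ] E')
    (P : Fin d → H →L[ℂ] H) (hE : finrank ℂ E = finrank ℂ E')
    (h₁ : adjoint A ∘L A + adjoint C ∘L C = 1) (h₂ : adjoint A ∘L B + adjoint C ∘L D = 0)
    (h₃ : adjoint B ∘L B + adjoint D ∘L D = 1)
    (hP : ∀ k, IsStarProjection (P k)) (hPP : ∀ j k, j ≠ k → P j * P k = 0)
    (hsum : ∑ k, P k = 1) : GRColligation d H E E' where
  -- An isometry between spaces of equal finite dimension is onto, so UU* = I need not be checked.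
  U := (isometryOfBlocks A B C D h₁ h₂ h₃).toLinearIsometryEquiv (by
    rw [(WithLp.linearEquiv 2 ℂ (H × E)).finrank_eq, (WithLp.linearEquiv 2 ℂ (H × E')).finrank_eq,
      Module.finrank_prod, Module.finrank_prod, hE])
  P := P
  isStarProjection_P := hP
  P_mul_P := hPP
  sum_P := hsum

variable {A : H →L[ℂ] H} {B : E →L[ℂ] H} {C : H →L[ℂ] E'} {D : E →L[ℂ] E'}
    {P : Fin d → H →L[ℂ] H} {hE : finrank ℂ E = finrank ℂ E'}
    {h₁ : adjoint A ∘L A + adjoint C ∘L C = 1} {h₂ : adjoint A ∘L B + adjoint C ∘L D = 0}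
    {h₃ : adjoint B ∘L B + adjoint D ∘L D = 1}
    {hP : ∀ k, IsStarProjection (P k)} {hPP : ∀ j k, j ≠ k → P j * P k = 0}
    {hsum : ∑ k, P k = 1}

theorem toProd_ofBlocks (x : H × E) :
    (ofBlocks A B C D P hE h₁ h₂ h₃ hP hPP hsum).toProd x =
      (A x.1 + B x.2, C x.1 + D x.2) := rfl

theorem A_ofBlocks : (ofBlocks A B C D P hE h₁ h₂ h₃ hP hPP hsum).A = A := by
  ext h; simp [GRColligation.A, toProd_ofBlocks]

theorem B_ofBlocks : (ofBlocks A B C D P hE h₁ h₂ h₃ hP hPP hsum).B = B := by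
  ext h; simp [GRColligation.B, toProd_ofBlocks]

theorem C_ofBlocks : (ofBlocks A B C D P hE h₁ h₂ h₃ hP hPP hsum).C = C := by
  ext h; simp [GRColligation.C, toProd_ofBlocks]

theorem D_ofBlocks : (ofBlocks A B C D P hE h₁ h₂ h₃ hP hPP hsum).D = D := by
  ext h; simp [GRColligation.D, toProd_ofBlocks]

end OfBlocks

end GRColligation

/-! ### Operators given by real matrices -/

section RealMatrixOp

variable {l m n : ℕ}

theorem realMatrixOp_apply (M : Matrix (Fin m) (Fin n) ℝ) (x : EuclideanSpace ℂ (Fin n))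
    (i : Fin m) : realMatrixOp M x i = ∑ j, (M i j : ℂ) * x j := by
  simp [realMatrixOp, Matrix.mulVec, dotProduct]

theorem realMatrixOp_mul (M : Matrix (Fin l) (Fin m) ℝ) (N : Matrix (Fin m) (Fin n) ℝ) :
    realMatrixOp (M * N) = realMatrixOp M ∘L realMatrixOp N := by
  ext x i
  simp only [realMatrixOp_apply, ContinuousLinearMap.comp_apply, Matrix.mul_apply,
    Complex.ofReal_sum, Complex.ofReal_mul, Finset.sum_mul, Finset.mul_sum]
  rw [Finset.sum_comm]
  simp only [mul_assoc]

theorem realMatrixOp_add (M N : Matrix (Fin m) (Fin n) ℝ) :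
    realMatrixOp (M + N) = realMatrixOp M + realMatrixOp N := by
  ext x i
  simp [realMatrixOp_apply, add_mul, Finset.sum_add_distrib]

theorem realMatrixOp_zero : realMatrixOp (0 : Matrix (Fin m) (Fin n) ℝ) = 0 := by
  ext x i
  simp [realMatrixOp_apply]

theorem realMatrixOp_one : realMatrixOp (1 : Matrix (Fin n) (Fin n) ℝ) = 1 := by
  ext x i
  simp [realMatrixOp_apply, Matrix.one_apply, apply_ite ((↑) : ℝ → ℂ)]

theorem adjoint_realMatrixOp (M : Matrix (Fin m) (Fin n) ℝ) :
    ContinuousLinearMap.adjoint (realMatrixOp M) = realMatrixOp M.transpose := by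
  symm
  rw [ContinuousLinearMap.eq_adjoint_iff]
  intro x y
  simp only [PiLp.inner_apply, RCLike.inner_apply, realMatrixOp_apply, map_sum, map_mul,
    Finset.mul_sum, Finset.sum_mul, Matrix.transpose_apply, Complex.conj_ofReal]
  rw [Finset.sum_comm]
  exact Finset.sum_congr rfl fun i _ => Finset.sum_congr rfl fun j _ => by ring

theorem isStarProjection_realMatrixOp {M : Matrix (Fin n) (Fin n) ℝ} (h : M * M = M)
    (h' : M.transpose = M) : IsStarProjection (realMatrixOp M) where
  isIdempotentElem := by
    rw [IsIdempotentElem, ContinuousLinearMap.mul_def, ← realMatrixOp_mul, h]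
  isSelfAdjoint := by
    rw [IsSelfAdjoint, ContinuousLinearMap.star_eq_adjoint, adjoint_realMatrixOp, h']

end RealMatrixOp

/-- The two-variable Givone–Roesser unitary colligation given by real matrices. -/
def GRColligation.ofRealMatrices {m n : ℕ} (A : Matrix (Fin m) (Fin m) ℝ)
    (B : Matrix (Fin m) (Fin n) ℝ) (C : Matrix (Fin n) (Fin m) ℝ) (D : Matrix (Fin n) (Fin n) ℝ)
    (P₁ P₂ : Matrix (Fin m) (Fin m) ℝ)
    (h₁ : A.transpose * A + C.transpose * C = 1) (h₂ : A.transpose * B + C.transpose * D = 0)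
    (h₃ : B.transpose * B + D.transpose * D = 1)
    (hP₁ : P₁ * P₁ = P₁) (hP₁' : P₁.transpose = P₁) (hP₂ : P₂ * P₂ = P₂)
    (hP₂' : P₂.transpose = P₂) (hP₁₂ : P₁ * P₂ = 0) (hP₂₁ : P₂ * P₁ = 0) (hsum : P₁ + P₂ = 1) :
    GRColligation 2 (EuclideanSpace ℂ (Fin m)) (EuclideanSpace ℂ (Fin n))
      (EuclideanSpace ℂ (Fin n)) :=
  GRColligation.ofBlocks (realMatrixOp A) (realMatrixOp B) (realMatrixOp C) (realMatrixOp D)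
    ![realMatrixOp P₁, realMatrixOp P₂] rfl
    (by rw [adjoint_realMatrixOp, adjoint_realMatrixOp, ← realMatrixOp_mul, ← realMatrixOp_mul,
      ← realMatrixOp_add, h₁, realMatrixOp_one])
    (by rw [adjoint_realMatrixOp, adjoint_realMatrixOp, ← realMatrixOp_mul, ← realMatrixOp_mul,
      ← realMatrixOp_add, h₂, realMatrixOp_zero])
    (by rw [adjoint_realMatrixOp, adjoint_realMatrixOp, ← realMatrixOp_mul, ← realMatrixOp_mul,
      ← realMatrixOp_add, h₃, realMatrixOp_one])
    (Fin.forall_fin_two.2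
      ⟨isStarProjection_realMatrixOp hP₁ hP₁', isStarProjection_realMatrixOp hP₂ hP₂'⟩)
    (by
      have e₁ : realMatrixOp P₁ * realMatrixOp P₂ = 0 := by
        rw [ContinuousLinearMap.mul_def, ← realMatrixOp_mul, hP₁₂, realMatrixOp_zero]
      have e₂ : realMatrixOp P₂ * realMatrixOp P₁ = 0 := by
        rw [ContinuousLinearMap.mul_def, ← realMatrixOp_mul, hP₂₁, realMatrixOp_zero]
      simp [Fin.forall_fin_two, e₁, e₂])
    (by
      rw [Fin.sum_univ_two]
      exact (realMatrixOp_add _ _).symm.trans (by rw [hsum, realMatrixOp_one]))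

/-! ### Matrix identities for the four-dimensional example -/

namespace FourDimExample

theorem s_mul_s : s * s = 1 / 2 := by
  rw [s, div_mul_div_comm, Real.mul_self_sqrt (by norm_num)]
  norm_num

theorem transpose_A_mul_A_add : A.transpose * A + C.transpose * C = 1 := by
  ext i j
  fin_cases i <;> fin_cases j <;>
    simp [Matrix.mul_apply, Fin.sum_univ_four, A, C] <;> linarith [s_mul_s]

theorem transpose_A_mul_B_add : A.transpose * B + C.transpose * D = 0 := by
  ext i j
  fin_cases i <;> fin_cases j <;>
    simp [Matrix.mul_apply, Fin.sum_univ_four, A, B, C, D]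

theorem transpose_B_mul_B_add : B.transpose * B + D.transpose * D = 1 := by
  ext i j
  fin_cases i; fin_cases j
  simp [Matrix.mul_apply, Fin.sum_univ_four, B, D]
  linarith [s_mul_s]

theorem P₁_mul_P₁ : P₁ * P₁ = P₁ := by
  ext i j
  fin_cases i <;> fin_cases j <;>
    simp [Matrix.mul_apply, Fin.sum_univ_four, P₁] <;> norm_num

theorem transpose_P₁ : P₁.transpose = P₁ := by
  ext i j
  fin_cases i <;> fin_cases j <;> simp [P₁]

theorem P₂_mul_P₂ : P₂ * P₂ = P₂ := by
  ext i j
  fin_cases i <;> fin_cases j <;>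
    simp [Matrix.mul_apply, Fin.sum_univ_four, P₂] <;> norm_num

theorem transpose_P₂ : P₂.transpose = P₂ := by
  ext i j
  fin_cases i <;> fin_cases j <;> simp [P₂]

theorem P₁_mul_P₂ : P₁ * P₂ = 0 := by
  ext i j
  fin_cases i <;> fin_cases j <;>
    simp [Matrix.mul_apply, Fin.sum_univ_four, P₁, P₂] <;> norm_num

theorem P₂_mul_P₁ : P₂ * P₁ = 0 := by
  ext i j
  fin_cases i <;> fin_cases j <;>
    simp [Matrix.mul_apply, Fin.sum_univ_four, P₁, P₂] <;> norm_num

theorem P₁_add_P₂ : P₁ + P₂ = 1 := by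
  ext i j
  fin_cases i <;> fin_cases j <;> simp [P₁, P₂] <;> norm_num

/-- The four-dimensional colligation. -/
def colligation : GRColligation 2 (EuclideanSpace ℂ (Fin 4)) (EuclideanSpace ℂ (Fin 1))
    (EuclideanSpace ℂ (Fin 1)) :=
  GRColligation.ofRealMatrices A B C D P₁ P₂
    transpose_A_mul_A_add transpose_A_mul_B_add transpose_B_mul_B_add
    P₁_mul_P₁ transpose_P₁ P₂_mul_P₂ transpose_P₂ P₁_mul_P₂ P₂_mul_P₁ P₁_add_P₂

theorem colligation_A : colligation.A = realMatrixOp A :=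
  GRColligation.A_ofBlocks (hE := rfl)
theorem colligation_B : colligation.B = realMatrixOp B :=
  GRColligation.B_ofBlocks (hE := rfl)
theorem colligation_C : colligation.C = realMatrixOp C :=
  GRColligation.C_ofBlocks (hE := rfl)
theorem colligation_D : colligation.D = realMatrixOp D :=
  GRColligation.D_ofBlocks (hE := rfl)
theorem colligation_P_zero : colligation.P 0 = realMatrixOp P₁ := rfl
theorem colligation_P_one : colligation.P 1 = realMatrixOp P₂ := rfl

end FourDimExample

/-! ### Matrix identities for the eight-dimensional example -/

namespace EightDimExample

theorem s_mul_s : s * s = 1 / 6 := by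
  rw [s, div_mul_div_comm, Real.mul_self_sqrt (by norm_num)]
  norm_num

/-- All entries of A and B thereby become integer multiples of `s`, and unitarity reduces to s² =
1/6. -/
theorem t_eq : t = 2 * s := by
  have h : (2 / 3 : ℝ) = (2 * s) ^ 2 := by linarith [s_mul_s]
  have hs : 0 ≤ s := by unfold s; positivity
  rw [t, h, Real.sqrt_sq (by positivity)]

theorem transpose_A_mul_A_add : A.transpose * A + C.transpose * C = 1 := by
  ext i j
  fin_cases i <;> fin_cases j <;>
    simp [Matrix.mul_apply, Fin.sum_univ_eight, Fin.sum_univ_three, A, C, t_eq] <;>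
    linarith [s_mul_s]

theorem transpose_A_mul_B_add : A.transpose * B + C.transpose * D = 0 := by
  ext i j
  fin_cases i <;> fin_cases j <;>
    simp [Matrix.mul_apply, Fin.sum_univ_eight, A, B, D, t_eq] <;> ring

theorem transpose_B_mul_B_add : B.transpose * B + D.transpose * D = 1 := by
  ext i j
  fin_cases i <;> fin_cases j <;>
    simp [Matrix.mul_apply, Fin.sum_univ_eight, B, D, t_eq] <;>
    linarith [s_mul_s]

theorem P₁_mul_P₁ : P₁ * P₁ = P₁ := by
  ext i j
  fin_cases i <;> fin_cases j <;>
    simp [Matrix.mul_apply, Fin.sum_univ_eight, P₁] <;> norm_num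

theorem transpose_P₁ : P₁.transpose = P₁ := by
  ext i j
  fin_cases i <;> fin_cases j <;> simp [P₁]

theorem P₂_mul_P₂ : P₂ * P₂ = P₂ := by
  ext i j
  fin_cases i <;> fin_cases j <;>
    simp [Matrix.mul_apply, Fin.sum_univ_eight, P₂] <;> norm_num

theorem transpose_P₂ : P₂.transpose = P₂ := by
  ext i j
  fin_cases i <;> fin_cases j <;> simp [P₂]

theorem P₁_mul_P₂ : P₁ * P₂ = 0 := by
  ext i j
  fin_cases i <;> fin_cases j <;>
    simp [Matrix.mul_apply, Fin.sum_univ_eight, P₁, P₂] <;> norm_num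

theorem P₂_mul_P₁ : P₂ * P₁ = 0 := by
  ext i j
  fin_cases i <;> fin_cases j <;>
    simp [Matrix.mul_apply, Fin.sum_univ_eight, P₁, P₂] <;> norm_num

theorem P₁_add_P₂ : P₁ + P₂ = 1 := by
  ext i j
  fin_cases i <;> fin_cases j <;> simp [P₁, P₂] <;> norm_num

/-- The eight-dimensional colligation. -/
def colligation : GRColligation 2 (EuclideanSpace ℂ (Fin 8)) (EuclideanSpace ℂ (Fin 3))
    (EuclideanSpace ℂ (Fin 3)) :=
  GRColligation.ofRealMatrices A B C D P₁ P₂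
    transpose_A_mul_A_add transpose_A_mul_B_add transpose_B_mul_B_add
    P₁_mul_P₁ transpose_P₁ P₂_mul_P₂ transpose_P₂ P₁_mul_P₂ P₂_mul_P₁ P₁_add_P₂

theorem colligation_A : colligation.A = realMatrixOp A :=
  GRColligation.A_ofBlocks (hE := rfl)
theorem colligation_B : colligation.B = realMatrixOp B :=
  GRColligation.B_ofBlocks (hE := rfl)
theorem colligation_C : colligation.C = realMatrixOp C :=
  GRColligation.C_ofBlocks (hE := rfl)
theorem colligation_D : colligation.D = realMatrixOp D :=
  GRColligation.D_ofBlocks (hE := rfl)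
theorem colligation_P_zero : colligation.P 0 = realMatrixOp P₁ := rfl
theorem colligation_P_one : colligation.P 1 = realMatrixOp P₂ := rfl

end EightDimExample

/-! ### The four-dimensional realization of z₁z₂ -/

namespace FourDimExample

open FormalLaurent

theorem s_mul_s_complex : (s : ℂ) * s = 1 / 2 := by
  have := congrArg ((↑) : ℝ → ℂ) s_mul_s
  push_cast at this
  exact this

theorem s_complex_ne_zero : (s : ℂ) ≠ 0 := by
  intro h
  have := s_mul_s_complex
  rw [h] at this
  norm_num at this

theorem op_A_apply (x : EuclideanSpace ℂ (Fin 4)) :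
    realMatrixOp A x = !₂[-s * x 2, s * x 2, s * (x 1 - x 0), s * (x 0 + x 1)] := by
  ext i
  fin_cases i <;> simp [realMatrixOp_apply, Fin.sum_univ_four, A] <;> ring

theorem op_transpose_A_apply (x : EuclideanSpace ℂ (Fin 4)) :
    realMatrixOp A.transpose x = !₂[s * (x 3 - x 2), s * (x 2 + x 3), s * (x 1 - x 0), 0] := by
  ext i
  fin_cases i <;> simp [realMatrixOp_apply, Fin.sum_univ_four, A] <;> ring

theorem op_B_apply (x : EuclideanSpace ℂ (Fin 1)) :
    realMatrixOp B x = !₂[s * x 0, s * x 0, 0, 0] := by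
  ext i
  fin_cases i <;> simp [realMatrixOp_apply, B]

theorem op_transpose_B_apply (x : EuclideanSpace ℂ (Fin 4)) :
    realMatrixOp B.transpose x = !₂[s * (x 0 + x 1)] := by
  ext i
  fin_cases i
  simp [realMatrixOp_apply, Fin.sum_univ_four, B]
  ring

theorem op_C_apply (x : EuclideanSpace ℂ (Fin 4)) : realMatrixOp C x = !₂[x 3] := by
  ext i
  fin_cases i
  simp [realMatrixOp_apply, Fin.sum_univ_four, C]

theorem op_P₁_apply (x : EuclideanSpace ℂ (Fin 4)) :
    realMatrixOp P₁ x = !₂[x 0, 0, (x 2 + x 3) / 2, (x 2 + x 3) / 2] := by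
  ext i
  fin_cases i <;> simp [realMatrixOp_apply, Fin.sum_univ_four, P₁] <;> ring

theorem op_P₂_apply (x : EuclideanSpace ℂ (Fin 4)) :
    realMatrixOp P₂ x = !₂[0, x 1, (x 2 - x 3) / 2, (x 3 - x 2) / 2] := by
  ext i
  fin_cases i <;> simp [realMatrixOp_apply, Fin.sum_univ_four, P₂] <;> ring

theorem mulZ_apply (f : FormalLaurent 2 (EuclideanSpace ℂ (Fin 4))) (n : Fin 2 → ℤ) :
    colligation.mulZ f n =
      realMatrixOp P₁ (f (n - Pi.single 0 1)) + realMatrixOp P₂ (f (n - Pi.single 1 1)) := by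
  rw [GRColligation.mulZ, Fin.sum_univ_two, colligation_P_zero, colligation_P_one]

theorem mulZinv_apply (f : FormalLaurent 2 (EuclideanSpace ℂ (Fin 4))) (n : Fin 2 → ℤ) :
    colligation.mulZinv f n =
      realMatrixOp P₁ (f (n + Pi.single 0 1)) + realMatrixOp P₂ (f (n + Pi.single 1 1)) := by
  rw [GRColligation.mulZinv, Fin.sum_univ_two, colligation_P_zero, colligation_P_one]

/-- A set of series invariant under `Z A` and annihilated by `C`. -/
def outputKernel : Set (FormalLaurent 2 (EuclideanSpace ℂ (Fin 4))) :=
  {f | ∀ n, f n 3 = 0 ∧ f (n - Pi.single 1 1) 0 + f (n - Pi.single 0 1) 1 = 0}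

/-- A set of series invariant under `Z⁻¹ A*` and annihilated by `B*`. -/
def inputKernel : Set (FormalLaurent 2 (EuclideanSpace ℂ (Fin 4))) :=
  {f | ∀ n, f n 0 + f n 1 = 0 ∧
    f (n + Pi.single 1 1) 2 + f (n + Pi.single 1 1) 3 =
      f (n + Pi.single 0 1) 2 - f (n + Pi.single 0 1) 3}

/-- Coordinate 3 of ZAf is s(z₂f₀ + z₁f₁), so the defining equations say Cf = 0 and CZAf = 0. They
persist because coordinates 0 and 1 of ZAf are −s z₁f₂ and s z₂f₂, which makes C(ZA)² vanish. -/
theorem mulZ_A_mem_outputKernel :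
    ∀ f ∈ outputKernel, (colligation.mulZ fun m => colligation.A (f m)) ∈ outputKernel := by
  intro f hf n
  simp only [mulZ_apply, colligation_A, op_A_apply, op_P₁_apply, op_P₂_apply]
  constructor
  · simp
    linear_combination (s : ℂ) * (hf n).2
  · simp [sub_right_comm n (Pi.single 1 1) (Pi.single 0 1)]

theorem C_eq_zero_of_mem_outputKernel :
    ∀ f ∈ outputKernel, ∀ n, colligation.C (f n) = 0 := by
  intro f hf n
  ext i
  fin_cases i
  simp [colligation_C, op_C_apply, (hf n).1]

/-- The defining equations say B*f = 0 and B*Z⁻¹A*f = 0. For g = Z⁻¹A*f and y = s(f₁ − f₀), one has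
g₂ + g₃ = z₁⁻¹y and g₂ − g₃ = z₂⁻¹y, hence z₂⁻¹(g₂ + g₃) = z₁⁻¹(g₂ − g₃). -/
theorem mulZinv_adjoint_A_mem_inputKernel :
    ∀ f ∈ inputKernel,
      (colligation.mulZinv fun m => ContinuousLinearMap.adjoint colligation.A (f m)) ∈
        inputKernel := by
  intro f hf n
  simp only [mulZinv_apply, colligation_A, adjoint_realMatrixOp, op_transpose_A_apply, op_P₁_apply,
    op_P₂_apply]
  constructor
  · simp
    linear_combination (s : ℂ) * (hf n).2
  · simp [add_right_comm n (Pi.single 1 1) (Pi.single 0 1)]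
    ring

theorem adjoint_B_eq_zero_of_mem_inputKernel :
    ∀ f ∈ inputKernel, ∀ n, ContinuousLinearMap.adjoint colligation.B (f n) = 0 := by
  intro f hf n
  ext i
  fin_cases i
  simp [colligation_B, adjoint_realMatrixOp, op_transpose_B_apply, (hf n).1]

theorem not_isStrictlyCloselyConnected : ¬ colligation.IsStrictlyCloselyConnected := by
  -- The output equations do not involve coordinate 2, and Z⁻¹e₂ has coordinates 2 and 3 with sum
  -- z₁⁻¹ and difference z₂⁻¹, as the input equations require.
  refine colligation.not_isStrictlyCloselyConnected_of_dBRMap_eq_zero (h := !₂[0, 0, 1, 0]) ?_ <|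
    colligation.dBRMap_eq_zero mulZ_A_mem_outputKernel C_eq_zero_of_mem_outputKernel
      mulZinv_adjoint_A_mem_inputKernel adjoint_B_eq_zero_of_mem_inputKernel
      (fun n => ?_) (fun n => ?_)
  · intro h
    simpa using congrArg (fun v : EuclideanSpace ℂ (Fin 4) => v 2) h
  · simp [const_eq_smul]
  · simp only [mulZinv_apply, const_eq_smul, op_P₁_apply, op_P₂_apply]
    constructor
    · simp
    · simp [add_right_comm n (Pi.single 1 1) (Pi.single 0 1)]
      ring

theorem not_isShiftedStrictlyCloselyConnected :
    ¬ colligation.IsShiftedStrictlyCloselyConnected := by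
  -- Here Zh = (z₁, −z₂, 0, 0) satisfies z₂f₀ + z₁f₁ = 0, while h itself satisfies the input
  -- equations.
  refine colligation.not_isShiftedStrictlyCloselyConnected_of_shiftedDBRMap_eq_zero
    (h := !₂[1, -1, 0, 0]) ?_ <|
    colligation.shiftedDBRMap_eq_zero mulZ_A_mem_outputKernel C_eq_zero_of_mem_outputKernel
      mulZinv_adjoint_A_mem_inputKernel adjoint_B_eq_zero_of_mem_inputKernel
      (fun n => ?_) (fun n => ?_)
  · intro h
    simpa using congrArg (fun v : EuclideanSpace ℂ (Fin 4) => v 0) h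
  · simp only [mulZ_apply, const_eq_smul, op_P₁_apply, op_P₂_apply]
    constructor
    · simp
    · simp [sub_right_comm n (Pi.single 1 1) (Pi.single 0 1)]
  · simp [const_eq_smul]

theorem isCloselyConnected : colligation.IsCloselyConnected := by
  refine (Submodule.eq_top_iff').2 fun h => ?_
  have hB := colligation.B_mem_closelyConnectedSubspace !₂[1]
  have h₀ := colligation.P_mem_closelyConnectedSubspace 0 hB
  have h₁ := colligation.P_mem_closelyConnectedSubspace 1 hB
  have h₂ := colligation.A_mem_closelyConnectedSubspace h₀
  have h₃ := colligation.A_mem_closelyConnectedSubspace h₁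
  -- The four vectors are s e₀, s e₁, (e₃ − e₂)/2 and (e₂ + e₃)/2; the coefficients expand `h` in
  -- this basis.
  have key := add_mem (add_mem (Submodule.smul_mem _ (h 0 / s) h₀)
    (Submodule.smul_mem _ (h 1 / s) h₁)) (add_mem (Submodule.smul_mem _ (h 3 - h 2) h₂)
      (Submodule.smul_mem _ (h 3 + h 2) h₃))
  convert key using 1
  have hs := s_complex_ne_zero
  simp only [colligation_A, colligation_B, colligation_P_zero, colligation_P_one, op_A_apply,
    op_B_apply, op_P₁_apply, op_P₂_apply]
  ext i
  fin_cases i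
  · simp [hs]
  · simp [hs]
  · simp
    linear_combination -2 * h 2 * s_mul_s_complex
  · simp
    linear_combination -2 * h 3 * s_mul_s_complex

theorem Z_apply (z : Fin 2 → ℂ) (x : EuclideanSpace ℂ (Fin 4)) :
    colligation.Z z x =
      !₂[z 0 * x 0, z 1 * x 1, (z 0 * (x 2 + x 3) + z 1 * (x 2 - x 3)) / 2,
        (z 0 * (x 2 + x 3) + z 1 * (x 3 - x 2)) / 2] := by
  simp only [GRColligation.Z, Fin.sum_univ_two, colligation_P_zero, colligation_P_one,
    add_apply, smul_apply, op_P₁_apply, op_P₂_apply]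
  ext i
  fin_cases i <;> simp <;> ring

theorem isUnit_one_sub_Z_mul_A {z : Fin 2 → ℂ} (hz : ∀ k, ‖z k‖ < 1) :
    IsUnit (1 - colligation.Z z * colligation.A) := by
  have hz' : 1 - z 0 * z 1 ≠ 0 := by
    intro h
    have h1 : ‖z 0 * z 1‖ < 1 := by
      rw [norm_mul]
      exact mul_lt_one_of_nonneg_of_lt_one_left (norm_nonneg _) (hz 0) (hz 1).le
    rw [← sub_eq_zero.1 h] at h1
    simp at h1
  have hinj : Function.Injective
      (1 - colligation.Z z * colligation.A :
        EuclideanSpace ℂ (Fin 4) →L[ℂ] EuclideanSpace ℂ (Fin 4)) := by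
    refine (injective_iff_map_eq_zero _).2 fun x hx => ?_
    simp only [sub_apply, one_apply_eq_self,
      mul_apply_eq_comp, colligation_A, op_A_apply, Z_apply] at hx
    have e₀ := congrArg (fun v : EuclideanSpace ℂ (Fin 4) => v 0) hx
    have e₁ := congrArg (fun v : EuclideanSpace ℂ (Fin 4) => v 1) hx
    have e₂ := congrArg (fun v : EuclideanSpace ℂ (Fin 4) => v 2) hx
    have e₃ := congrArg (fun v : EuclideanSpace ℂ (Fin 4) => v 3) hx
    simp at e₀ e₁ e₂ e₃
    -- Eliminating x₀ and x₁ from the equation for x₂ leaves (1 − z₁z₂)x₂ = 0.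
    have x₂ : x 2 = 0 := by
      apply mul_left_cancel₀ hz'
      linear_combination e₂ + s * z 0 * e₁ - s * z 1 * e₀ + 2 * z 0 * z 1 * x 2 * s_mul_s_complex
    have x₀ : x 0 = 0 := by linear_combination e₀ - s * z 0 * x₂
    have x₁ : x 1 = 0 := by linear_combination e₁ + s * z 1 * x₂
    have x₃ : x 3 = 0 := by linear_combination e₃ + s * z 0 * x₁ + s * z 1 * x₀
    ext i
    fin_cases i <;> simp [x₀, x₁, x₂, x₃]
  rw [ContinuousLinearMap.isUnit_iff_bijective]
  exact ⟨hinj, LinearMap.injective_iff_surjective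
    (f := (1 - colligation.Z z * colligation.A : _ →L[ℂ] _).toLinearMap).1 hinj⟩

theorem transferFunction_eq {z : Fin 2 → ℂ} (hz : ∀ k, ‖z k‖ < 1) :
    colligation.transferFunction z = (z 0 * z 1) • 1 := by
  have hu := isUnit_one_sub_Z_mul_A hz
  ext e i
  -- The vector is the terminating Neumann series ZBe + ZAZBe; the next term vanishes since A e₃ =
  -- 0.
  have key : (1 - colligation.Z z * colligation.A)
      !₂[s * z 0 * e 0, s * z 1 * e 0, 0, z 0 * z 1 * e 0] = colligation.Z z (colligation.B e) := by
    simp only [sub_apply, one_apply_eq_self,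
      mul_apply_eq_comp, colligation_A, colligation_B, op_A_apply, op_B_apply, Z_apply]
    ext i
    fin_cases i
    · simp
      ring
    · simp
      ring
    · simp
      ring
    · simp
      linear_combination -2 * z 0 * z 1 * e 0 * s_mul_s_complex
  have hinv (x) : Ring.inverse (1 - colligation.Z z * colligation.A)
      ((1 - colligation.Z z * colligation.A) x) = x :=
    congrArg (fun L : EuclideanSpace ℂ (Fin 4) →L[ℂ] _ => L x) (Ring.inverse_mul_cancel _ hu)
  have hD : colligation.D e = 0 := by
    rw [colligation_D]
    ext i
    fin_cases i
    simp [realMatrixOp_apply, D]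
  rw [GRColligation.transferFunction]
  simp only [add_apply, ContinuousLinearMap.comp_apply]
  rw [← key, hinv, hD, colligation_C, op_C_apply]
  fin_cases i
  simp

end FourDimExample

/-! ### The eight-dimensional example -/

namespace EightDimExample

open FormalLaurent

theorem s_complex_ne_zero : (s : ℂ) ≠ 0 := by
  intro h
  have := s_mul_s
  rw [Complex.ofReal_eq_zero.1 h] at this
  norm_num at this

theorem op_A_apply (x : EuclideanSpace ℂ (Fin 8)) :
    realMatrixOp A x = (s : ℂ) • !₂[x 3 + x 4, 2 * x 4, 2 * x 3, x 0 + 2 * x 2, x 0 + 2 * x 1,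
      x 3 - x 4, x 2 - x 1, x 1 + x 2 - 2 * x 0] := by
  ext i
  fin_cases i <;> simp [realMatrixOp_apply, Fin.sum_univ_eight, A, t_eq] <;> ring

theorem op_transpose_A_apply (x : EuclideanSpace ℂ (Fin 8)) :
    realMatrixOp A.transpose x = (s : ℂ) • !₂[x 3 + x 4 - 2 * x 7, 2 * x 4 - x 6 + x 7,
      2 * x 3 + x 6 + x 7, x 0 + 2 * x 2 + x 5, x 0 + 2 * x 1 - x 5, 0, 0, 0] := by
  ext i
  fin_cases i <;> simp [realMatrixOp_apply, Fin.sum_univ_eight, A, t_eq] <;> ring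

theorem op_transpose_B_apply (x : EuclideanSpace ℂ (Fin 8)) :
    realMatrixOp B.transpose x = (s : ℂ) • !₂[x 3 - x 4 - 2 * x 6, x 2 - x 1 - 2 * x 5,
      x 1 + x 2 - 2 * x 0] := by
  ext i
  fin_cases i <;> simp [realMatrixOp_apply, Fin.sum_univ_eight, B, t_eq] <;> ring

theorem op_C_apply (x : EuclideanSpace ℂ (Fin 8)) :
    realMatrixOp C x = !₂[x 5, x 6, x 7] := by
  ext i
  fin_cases i <;> simp [realMatrixOp_apply, Fin.sum_univ_eight, C]

theorem op_P₁_apply (x : EuclideanSpace ℂ (Fin 8)) :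
    realMatrixOp P₁ x = !₂[(5 * x 0 - 2 * x 2 - x 5) / 6, 0, (x 2 - x 0 - x 5) / 3, x 3,
      (2 * x 4 - x 6 + x 7) / 3, (5 * x 5 - x 0 - 2 * x 2) / 6, (x 6 - x 7 - 2 * x 4) / 6,
      (x 7 - x 6 + 2 * x 4) / 6] := by
  ext i
  fin_cases i <;> simp [realMatrixOp_apply, Fin.sum_univ_eight, P₁] <;> ring

theorem op_P₂_apply (x : EuclideanSpace ℂ (Fin 8)) :
    realMatrixOp P₂ x = !₂[(x 0 + 2 * x 2 + x 5) / 6, x 1, (x 0 + 2 * x 2 + x 5) / 3, 0,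
      (x 4 + x 6 - x 7) / 3, (x 0 + 2 * x 2 + x 5) / 6, (5 * x 6 + x 7 + 2 * x 4) / 6,
      (5 * x 7 + x 6 - 2 * x 4) / 6] := by
  ext i
  fin_cases i <;> simp [realMatrixOp_apply, Fin.sum_univ_eight, P₂] <;> ring

theorem mulZ_apply (f : FormalLaurent 2 (EuclideanSpace ℂ (Fin 8))) (n : Fin 2 → ℤ) :
    colligation.mulZ f n =
      realMatrixOp P₁ (f (n - Pi.single 0 1)) + realMatrixOp P₂ (f (n - Pi.single 1 1)) := by
  rw [GRColligation.mulZ, Fin.sum_univ_two, colligation_P_zero, colligation_P_one]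

theorem mulZinv_apply (f : FormalLaurent 2 (EuclideanSpace ℂ (Fin 8))) (n : Fin 2 → ℤ) :
    colligation.mulZinv f n =
      realMatrixOp P₁ (f (n + Pi.single 0 1)) + realMatrixOp P₂ (f (n + Pi.single 1 1)) := by
  rw [GRColligation.mulZinv, Fin.sum_univ_two, colligation_P_zero, colligation_P_one]

theorem C_eq_zero_iff (x : EuclideanSpace ℂ (Fin 8)) :
    realMatrixOp C x = 0 ↔ x 5 = 0 ∧ x 6 = 0 ∧ x 7 = 0 := by
  rw [op_C_apply]
  constructor
  · intro h
    exact ⟨congrArg (fun v : EuclideanSpace ℂ (Fin 3) => v 0) h,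
      congrArg (fun v : EuclideanSpace ℂ (Fin 3) => v 1) h,
      congrArg (fun v : EuclideanSpace ℂ (Fin 3) => v 2) h⟩
  · rintro ⟨h₅, h₆, h₇⟩
    ext i
    fin_cases i <;> simp [h₅, h₆, h₇]

theorem transpose_B_eq_zero_iff (x : EuclideanSpace ℂ (Fin 8)) :
    realMatrixOp B.transpose x = 0 ↔
      x 3 - x 4 - 2 * x 6 = 0 ∧ x 2 - x 1 - 2 * x 5 = 0 ∧ x 1 + x 2 - 2 * x 0 = 0 := by
  rw [op_transpose_B_apply, smul_eq_zero_iff_right s_complex_ne_zero]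
  constructor
  · intro h
    exact ⟨congrArg (fun v : EuclideanSpace ℂ (Fin 3) => v 0) h,
      congrArg (fun v : EuclideanSpace ℂ (Fin 3) => v 1) h,
      congrArg (fun v : EuclideanSpace ℂ (Fin 3) => v 2) h⟩
  · rintro ⟨h₀, h₁, h₂⟩
    ext i
    fin_cases i <;> simp [h₀, h₁, h₂]

theorem isStrictlyCloselyConnected : colligation.IsStrictlyCloselyConnected := by
  refine colligation.isStrictlyCloselyConnected_of_forall fun h hC hB => ?_
  rw [colligation_C, C_eq_zero_iff] at hC
  obtain ⟨h₅, h₆, h₇⟩ := hC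
  have b₀ := hB 0
  have b₁ := hB 1
  rw [colligation_B, adjoint_realMatrixOp, colligation_P_zero, transpose_B_eq_zero_iff,
    op_P₁_apply] at b₀
  rw [colligation_B, adjoint_realMatrixOp, colligation_P_one, transpose_B_eq_zero_iff,
    op_P₂_apply] at b₁
  simp [h₅, h₆, h₇] at b₀ b₁
  -- Once C h = 0, the P₁ equations determine h₃, h₂, h₀ and the P₂ equations determine h₄, h₁.
  obtain ⟨a₀, a₁, a₂⟩ := b₀
  obtain ⟨c₀, c₁, -⟩ := b₁
  have h₃ : h 3 = 0 := by linear_combination a₀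
  have h₂ : h 2 = 0 := by linear_combination a₁
  have h₀ : h 0 = 0 := by linear_combination (h₂ - a₂) / 2
  have h₄ : h 4 = 0 := by linear_combination -c₀
  have h₁ : h 1 = 0 := by linear_combination -c₁
  ext i
  fin_cases i <;> simp [h₀, h₁, h₂, h₃, h₄, h₅, h₆, h₇]

theorem isShiftedStrictlyCloselyConnected : colligation.IsShiftedStrictlyCloselyConnected := by
  refine colligation.isShiftedStrictlyCloselyConnected_of_forall fun h hC hB => ?_
  rw [colligation_B, adjoint_realMatrixOp, transpose_B_eq_zero_iff] at hB
  obtain ⟨b₀, b₁, b₂⟩ := hB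
  have c₀ := hC 0
  have c₁ := hC 1
  rw [colligation_C, colligation_P_zero, C_eq_zero_iff, op_P₁_apply] at c₀
  rw [colligation_C, colligation_P_one, C_eq_zero_iff, op_P₂_apply] at c₁
  obtain ⟨a₀, a₁, a₂⟩ := c₀
  obtain ⟨d₀, d₁, d₂⟩ := c₁
  simp only [Matrix.cons_val] at a₀ a₁ a₂ d₀ d₁ d₂
  -- Adding C P₁h = 0 and C P₂h = 0 gives C h = 0, which is coordinates 5, 6 and 7.
  have h₅ : h 5 = 0 := by linear_combination a₀ + d₀
  have h₆ : h 6 = 0 := by linear_combination a₁ + d₁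
  have h₇ : h 7 = 0 := by linear_combination a₂ + d₂
  have h₄ : h 4 = 0 := by linear_combination -3 * a₁ + (h₆ - h₇) / 2
  have h₃ : h 3 = 0 := by linear_combination b₀ + h₄ + 2 * h₆
  have h₀ : h 0 = 0 := by linear_combination h₅ - 2 * a₀ - (b₁ + b₂) / 3
  have h₂ : h 2 = 0 := by linear_combination (b₁ + b₂) / 2 + h₀ + h₅
  have h₁ : h 1 = 0 := by linear_combination b₂ - h₂ + 2 * h₀
  ext i
  fin_cases i <;> simp [h₀, h₁, h₂, h₃, h₄, h₅, h₆, h₇]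

/-- A set of series invariant under `Z A` and `A* Z⁻¹` and annihilated by `C` and `B* Z⁻¹`. -/
def ioKernel : Set (FormalLaurent 2 (EuclideanSpace ℂ (Fin 8))) :=
  {f | ∀ n, f n 2 = f n 0 ∧ f n 5 = 0 ∧ f n 6 = 0 ∧ f n 7 = 0 ∧
    f (n + Pi.single 0 1) 0 = f (n + Pi.single 1 1) 1 ∧
    f (n + Pi.single 0 1) 3 = f (n + Pi.single 1 1) 4}

/-- Members of `ioKernel` have the form (z₁g, z₂g, z₁g, z₁k, z₂k, 0, 0, 0). On them ZA acts by g ↦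
2s z₂k, k ↦ 3s z₁g, so the form is kept. -/
theorem mulZ_A_apply {f : FormalLaurent 2 (EuclideanSpace ℂ (Fin 8))} (hf : f ∈ ioKernel)
    (n : Fin 2 → ℤ) :
    colligation.mulZ (fun m => colligation.A (f m)) n =
      (s : ℂ) • !₂[2 * f (n - Pi.single 0 1) 4, 2 * f (n - Pi.single 1 1) 4,
        2 * f (n - Pi.single 0 1) 4, 3 * f (n - Pi.single 0 1) 0, 3 * f (n - Pi.single 0 1) 1,
        0, 0, 0] := by
  obtain ⟨a₂, -⟩ := hf (n - Pi.single 0 1)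
  obtain ⟨b₂, -⟩ := hf (n - Pi.single 1 1)
  -- Shifting by both exponents turns the relations into z₂f₀ = z₁f₁ and z₂f₃ = z₁f₄ at `n`.
  obtain ⟨-, -, -, -, e, e'⟩ := hf (n - Pi.single 0 1 - Pi.single 1 1)
  rw [sub_add_cancel, sub_right_comm, sub_add_cancel] at e e'
  simp only [mulZ_apply, colligation_A, op_A_apply, map_smul, ← smul_add, op_P₁_apply, op_P₂_apply]
  congr 1
  ext i
  fin_cases i <;> simp [a₂, b₂, e, e'] <;> ring

/-- In the same parameters A*Z⁻¹ acts by g ↦ 2s z₁⁻¹k, k ↦ 3s z₂⁻¹g. It undoes ZA, because A*A = I −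
C*C and C vanishes on `ioKernel`. -/
theorem adjoint_A_mulZinv_apply {f : FormalLaurent 2 (EuclideanSpace ℂ (Fin 8))}
    (hf : f ∈ ioKernel) (n : Fin 2 → ℤ) :
    ContinuousLinearMap.adjoint colligation.A (colligation.mulZinv f n) =
      (s : ℂ) • !₂[2 * f (n + Pi.single 1 1) 4, 2 * f (n + Pi.single 0 1) 4,
        2 * f (n + Pi.single 1 1) 4, 3 * f (n + Pi.single 1 1) 0, 3 * f (n + Pi.single 0 1) 0,
        0, 0, 0] := by
  obtain ⟨a₂, a₅, a₆, a₇, -⟩ := hf (n + Pi.single 0 1)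
  obtain ⟨b₂, b₅, b₆, b₇, -⟩ := hf (n + Pi.single 1 1)
  obtain ⟨-, -, -, -, e, e'⟩ := hf n
  simp only [mulZinv_apply, colligation_A, adjoint_realMatrixOp, op_transpose_A_apply, op_P₁_apply,
    op_P₂_apply]
  congr 1
  ext i
  fin_cases i <;> simp [a₂, b₂, a₅, b₅, a₆, b₆, a₇, b₇, e, e'] <;> ring

theorem mulZ_A_mem_ioKernel :
    ∀ f ∈ ioKernel, (colligation.mulZ fun m => colligation.A (f m)) ∈ ioKernel := by
  intro f hf n
  obtain ⟨-, -, -, -, e, -⟩ := hf (n - Pi.single 0 1)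
  rw [sub_add_cancel, sub_add_eq_add_sub] at e
  simp [mulZ_A_apply hf, e]

theorem adjoint_A_mulZinv_mem_ioKernel :
    ∀ f ∈ ioKernel,
      (fun m => ContinuousLinearMap.adjoint colligation.A (colligation.mulZinv f m)) ∈
        ioKernel := by
  intro f hf n
  simp [adjoint_A_mulZinv_apply hf, add_right_comm n (Pi.single 1 1) (Pi.single 0 1)]

theorem C_eq_zero_of_mem_ioKernel : ∀ f ∈ ioKernel, ∀ n, colligation.C (f n) = 0 := by
  intro f hf n
  obtain ⟨-, h₅, h₆, h₇, -⟩ := hf n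
  rw [colligation_C, C_eq_zero_iff]
  exact ⟨h₅, h₆, h₇⟩

theorem adjoint_B_mulZinv_eq_zero :
    ∀ f ∈ ioKernel, ∀ n,
      ContinuousLinearMap.adjoint colligation.B (colligation.mulZinv f n) = 0 := by
  intro f hf n
  obtain ⟨a₂, a₅, a₆, a₇, -⟩ := hf (n + Pi.single 0 1)
  obtain ⟨b₂, b₅, b₆, b₇, -⟩ := hf (n + Pi.single 1 1)
  obtain ⟨-, -, -, -, e, e'⟩ := hf n
  rw [colligation_B, adjoint_realMatrixOp, transpose_B_eq_zero_iff]
  simp only [mulZinv_apply, op_P₁_apply, op_P₂_apply]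
  refine ⟨?_, ?_, ?_⟩ <;> simp [a₂, b₂, a₅, b₅, a₆, b₆, a₇, b₇, e, e'] <;> ring

/-- Boundary data that produce neither input nor output. -/
def silentData : FormalLaurent 2 (EuclideanSpace ℂ (Fin 8)) :=
  const !₂[0, 0, 0, 0, 1, 0, 0, 0] +
    mulMonomial (Pi.single 0 1 - Pi.single 1 1) (const !₂[0, 0, 0, 1, 0, 0, 0, 0])

/-- This is the member with g = 0 and k = z₂⁻¹, the choice that puts z₁k and z₂k in degree zero. -/
theorem silentData_mem_ioKernel : silentData ∈ ioKernel := by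
  intro n
  simp [silentData, mulMonomial, const_eq_smul, ← sub_add]

theorem silentData_ne_zero : silentData ≠ 0 := by
  intro h
  have := congrArg (fun v : EuclideanSpace ℂ (Fin 8) => v 4) (congrFun h 0)
  simp [silentData, mulMonomial, const_eq_smul] at this

theorem isHomogeneous_silentData : IsHomogeneous silentData 0 := by
  refine (isHomogeneous_const _).add ?_
  convert isHomogeneous_mulMonomial (isHomogeneous_const _) using 1
  simp

theorem silentData_mem_boundaryData :
    silentData ∈ colligation.boundaryData (balancedLattice 2) := by
  refine colligation.mem_boundaryData_of_isHomogeneous isHomogeneous_silentData ?_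
  exact ((finite_support_const _).union
    (finite_support_mulMonomial (finite_support_const _))).subset (Function.support_add _ _)

theorem not_isScatteringMinimal : ¬ colligation.IsScatteringMinimal := by
  intro h
  refine silentData_ne_zero (h silentData_mem_boundaryData
    (colligation.mem_boundaryData_of_isHomogeneous (fun _ _ => rfl) (by simp)) ?_)
  rw [colligation.dBRBoundaryMap_zero]
  exact colligation.dBRBoundaryMap_eq_zero mulZ_A_mem_ioKernel C_eq_zero_of_mem_ioKernel
    adjoint_A_mulZinv_mem_ioKernel adjoint_B_mulZinv_eq_zero silentData_mem_ioKernel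
    isHomogeneous_silentData

end EightDimExample

end

theorem corollary6p5 :
    -- the implications, for every Givone–Roesser unitary colligation
    (∀ (d : ℕ) (H E E' : Type*)
      [NormedAddCommGroup H] [InnerProductSpace ℂ H] [CompleteSpace H]
      [NormedAddCommGroup E] [InnerProductSpace ℂ E] [CompleteSpace E]
      [NormedAddCommGroup E'] [InnerProductSpace ℂ E'] [CompleteSpace E']
      (U : GRColligation d H E E'),
      (U.IsScatteringMinimal → U.IsStrictlyCloselyConnected) ∧
      (U.IsStrictlyCloselyConnected → U.IsCloselyConnected) ∧
      (U.IsScatteringMinimal → U.IsShiftedStrictlyCloselyConnected) ∧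
      (U.IsShiftedStrictlyCloselyConnected → U.IsCloselyConnected)) ∧
    -- the 4-dimensional realization of `z₁ z₂`
    (∃ U : GRColligation 2 (EuclideanSpace ℂ (Fin 4))
        (EuclideanSpace ℂ (Fin 1)) (EuclideanSpace ℂ (Fin 1)),
      U.A = realMatrixOp FourDimExample.A ∧ U.B = realMatrixOp FourDimExample.B ∧
      U.C = realMatrixOp FourDimExample.C ∧ U.D = realMatrixOp FourDimExample.D ∧
      U.P 0 = realMatrixOp FourDimExample.P₁ ∧ U.P 1 = realMatrixOp FourDimExample.P₂ ∧
      (∀ z : Fin 2 → ℂ, (∀ k, ‖z k‖ < 1) → U.transferFunction z = (z 0 * z 1) • 1) ∧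
      U.IsCloselyConnected ∧
      ¬ U.IsStrictlyCloselyConnected ∧
      ¬ U.IsShiftedStrictlyCloselyConnected) ∧
    -- the 8-dimensional example
    (∃ U : GRColligation 2 (EuclideanSpace ℂ (Fin 8))
        (EuclideanSpace ℂ (Fin 3)) (EuclideanSpace ℂ (Fin 3)),
      U.A = realMatrixOp EightDimExample.A ∧ U.B = realMatrixOp EightDimExample.B ∧
      U.C = realMatrixOp EightDimExample.C ∧ U.D = realMatrixOp EightDimExample.D ∧
      U.P 0 = realMatrixOp EightDimExample.P₁ ∧ U.P 1 = realMatrixOp EightDimExample.P₂ ∧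
      U.IsStrictlyCloselyConnected ∧
      U.IsShiftedStrictlyCloselyConnected ∧
      ¬ U.IsScatteringMinimal) := by
  refine ⟨fun d H E E' _ _ _ _ _ _ _ _ _ U => ⟨fun h => h.isStrictlyCloselyConnected,
    fun h => h.isCloselyConnected, fun h => h.isShiftedStrictlyCloselyConnected,
    fun h => h.isCloselyConnected⟩, ?_, ?_⟩
  · open FourDimExample in
    exact ⟨colligation, colligation_A, colligation_B, colligation_C, colligation_D,
      colligation_P_zero, colligation_P_one, fun z hz => transferFunction_eq hz,
      isCloselyConnected, not_isStrictlyCloselyConnected, not_isShiftedStrictlyCloselyConnected⟩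
  · open EightDimExample in
    exact ⟨colligation, colligation_A, colligation_B, colligation_C, colligation_D,
      colligation_P_zero, colligation_P_one, isStrictlyCloselyConnected,
      isShiftedStrictlyCloselyConnected, not_isScatteringMinimal⟩
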